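/- Let $\mathcal K$ be the set of open double cones in $(1+1)$-dimensional Minkowski space. Let $\mathcal O\mapsto\mathcal F(\mathcal O)$, $\mathcal O\in\mathcal K$, be a net of von Neumann algebras on a complex Hilbert space $\mathcal H$ with $\mathcal F(\mathcal O_1)\subset\mathcal F(\mathcal O_2)$ for $\mathcal O_1\subset\mathcal O_2$, graded by $\alpha_-=\mathrm{Ad}\,V$ with $V=V^*=V^{-1}$, $\alpha_-(\mathcal F(\mathcal O))=\mathcal F(\mathcal O)$, and graded-local: for spacelike separated double cones, elements with $\alpha_-(x)=x$ (even) commute with all elements, and elements with $\alpha_-(x)=-x$ (odd) anticommute with odd elements. Put $X^t=ZXZ^*$ with $Z=\frac{1+iV}{1+i}$; let $\mathcal O'$ be the interior of the set of points spacelike to all points of $\mathcal O$, let $\mathcal F(\mathcal O')$ be the algebra generated by all $\mathcal F(\mathcal O_1)$, $\mathcal O_1\in\mathcal K$, $\mathcal O_1\subset\mathcal O'$, and write $\mathcal O\subset\subset\hat{\mathcal O}$ if $\overline{\mathcal O}\subset\hat{\mathcal O}$. Denote by $M'$ the commutant of $M$, by $M\vee N$ the von Neumann algebra generated by $M$ and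 $N$, and put $M\wedge N=M\cap N$. Assume: 1. (Twisted Haag duality) $\mathcal F(\mathcal O)^t=\mathcal F(\mathcal O')'$ for all $\mathcal O\in\mathcal K$. 2. (Split property) If $\mathcal O\subset\subset\hat{\mathcal O}$, there is a type I factor $N$ with $\mathcal F(\mathcal O)\subset N\subset\mathcal F(\hat{\mathcal O})$. 3. Every $\mathcal F(\mathcal O)$, $\mathcal O\in\mathcal K$, is a factor. 4. (Minimality of twisted relative commutants) If $\mathcal O\subset\subset\hat{\mathcal O}$ and $\mathcal O_1,\mathcal O_2\in\mathcal K$ are the two connected components of $\hat{\mathcal O}\cap\mathcal O'$, then $\mathcal F(\hat{\mathcal O})\wedge(\mathcal F(\mathcal O)^t)'=\mathcal F(\mathcal O_1)\vee\mathcal F(\mathcal O_2)$. 5. Either $\alpha_-$ restricts to an outer automorphism of $\mathcal F(\mathcal O)$ for every $\mathcal O\in\mathcal K$, or (pure Bose case) $\alpha_-$ acts trivially on every $\mathcal F(\mathcal O)$. Then $\mathcal F$ is strongly additive: if $\mathcal O_1,\mathcal O_2\in\mathcal K$ are spacelike to each other and have a common boundary point, then there is a smallest double cone $\tilde{\mathcal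 O}$ containing $\mathcal O_1$ and $\mathcal O_2$, and $\mathcal F(\mathcal O_1)\vee\mathcal F(\mathcal O_2)=\mathcal F(\tilde{\mathcal O})$. -/

import Mathlib

namespace SolitonNet

/-! ### Causal structure of two-dimensional Minkowski space -/

/-- Minkowski space in `1+1` dimensions: `x.1` is the time and `x.2` the space coordinate. -/
abbrev Minkowski : Type := ℝ × ℝ

/-- `y` lies in the open forward light cone with apex `x`. -/
def InFuture (x y : Minkowski) : Prop := |y.2 - x.2| < y.1 - x.1

/-- `x` and `y` are spacelike to each other. -/
def Spacelike (x y : Minkowski) : Prop := |y.1 - x.1| < |y.2 - x.2|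

/-- The sets `(a + V₊) ∩ (b - V₊)` with `b ∈ a + V₊`, where `V₊` is the open forward cone. -/
def IsDoubleCone (S : Set Minkowski) : Prop :=
  ∃ a b : Minkowski, InFuture a b ∧ S = {x | InFuture a x ∧ InFuture x b}

/-- The set of all double cones, ordered by inclusion. -/
abbrev DoubleCone : Type := {S : Set Minkowski // IsDoubleCone S}

/-- The two regions are spacelike to each other. -/
def SpacelikeRegions (S T : Set Minkowski) : Prop := ∀ x ∈ S, ∀ y ∈ T, Spacelike x y

/-- The (open) spacelike complement of a region. -/
def spacelikeComplement (S : Set Minkowski) : Set Minkowski :=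
  interior {y | ∀ x ∈ S, Spacelike x y}

/-- The double cone `P` lies, together with its closure, inside the (open) double cone `Q`. -/
def CompactlyInside (P Q : DoubleCone) : Prop := closure P.1 ⊆ Q.1

/-- `O₁` and `O₂` are the two connected components of the relative spacelike complement
of `P` in `Q`. -/
def AreComplementComponents (P Q O₁ O₂ : DoubleCone) : Prop :=
  Disjoint O₁.1 O₂.1 ∧ Q.1 ∩ spacelikeComplement P.1 = O₁.1 ∪ O₂.1

/-! ### Von Neumann algebras -/

section Algebras

variable {H : Type*} [NormedAddCommGroup H] [InnerProductSpace ℂ H] [CompleteSpace H]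

/-- The von Neumann algebra generated by a set of bounded operators (its double commutant, after
closing the set under adjoints). -/
noncomputable def vnGenerated (S : Set (H →L[ℂ] H)) : VonNeumannAlgebra H where
  toStarSubalgebra :=
    StarSubalgebra.centralizer ℂ (StarSubalgebra.centralizer ℂ S : Set (H →L[ℂ] H))
  centralizer_centralizer' := by
    change Set.centralizer (Set.centralizer
      ((StarSubalgebra.centralizer ℂ (StarSubalgebra.centralizer ℂ S : Set (H →L[ℂ] H)) :
        StarSubalgebra ℂ (H →L[ℂ] H)) : Set (H →L[ℂ] H))) =
      ((StarSubalgebra.centralizer ℂ (StarSubalgebra.centralizer ℂ S : Set (H →L[ℂ] H)) :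
        StarSubalgebra ℂ (H →L[ℂ] H)) : Set (H →L[ℂ] H))
    rw [StarSubalgebra.coe_centralizer, Set.centralizer_centralizer_centralizer]

/-- The algebra generated by `S` is the smallest von Neumann algebra containing `S`. -/
theorem vnGenerated_le_iff (S : Set (H →L[ℂ] H)) (M : VonNeumannAlgebra H) :
    vnGenerated S ≤ M ↔ S ⊆ (M : Set (H →L[ℂ] H)) := by
  have key : ((vnGenerated S : VonNeumannAlgebra H) : Set (H →L[ℂ] H)) =
      Set.centralizer (Set.centralizer (S ∪ star S)) :=
    StarSubalgebra.coe_centralizer_centralizer (R := ℂ) S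
  constructor
  · intro h x hx
    refine h ?_
    rw [← SetLike.mem_coe, key]
    exact Set.subset_centralizer_centralizer (Or.inl hx)
  · intro h x hx
    rw [← SetLike.mem_coe, key] at hx
    rw [← SetLike.mem_coe, ← M.centralizer_centralizer]
    refine Set.centralizer_subset (Set.centralizer_subset ?_) hx
    rintro y (hy | hy)
    · exact h hy
    · have hs : star y ∈ M := h hy
      have := star_mem hs
      rwa [star_star] at this

/-- `M ∨ N`, the von Neumann algebra generated by `M` and `N`. -/
noncomputable def vnJoin (M N : VonNeumannAlgebra H) : VonNeumannAlgebra H :=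
  vnGenerated ((M : Set (H →L[ℂ] H)) ∪ (N : Set (H →L[ℂ] H)))

/-- A factor: a von Neumann algebra with trivial center. -/
def IsFactor (M : VonNeumannAlgebra H) : Prop :=
  ∀ z ∈ M, z ∈ M.commutant → ∃ c : ℂ, z = c • (1 : H →L[ℂ] H)

/-- A type I factor: a factor possessing a minimal projection. -/
def IsTypeIFactor (M : VonNeumannAlgebra H) : Prop :=
  IsFactor M ∧ ∃ p ∈ M, IsStarProjection p ∧ p ≠ 0 ∧ ∀ x ∈ M, ∃ c : ℂ, p * x * p = c • p

/-- The operator `Z = (1 + iV) / (1 + i)`. -/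
noncomputable def twistOperator (V : H →L[ℂ] H) : H →L[ℂ] H :=
  (1 + Complex.I)⁻¹ • (1 + Complex.I • V)

/-- The twisted algebra `Mᵗ = Z M Z*`. -/
def twisted (V : H →L[ℂ] H) (M : VonNeumannAlgebra H) : Set (H →L[ℂ] H) :=
  (fun x => twistOperator V * x * star (twistOperator V)) '' (M : Set (H →L[ℂ] H))

end Algebras

/-! ### Graded-local nets -/

/-- A graded-local net `O ↦ F(O)` of von Neumann algebras on `H`, with the grading automorphism
`α₋ = Ad V`, where `V` is a self-adjoint unitary. The fields `even_comm` and `odd_anticomm` are the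
Bose-Fermi commutation relations. -/
structure GradedLocalNet (H : Type*) [NormedAddCommGroup H] [InnerProductSpace ℂ H]
    [CompleteSpace H] where
  alg : DoubleCone → VonNeumannAlgebra H
  V : H →L[ℂ] H
  V_selfAdjoint : star V = V
  V_sq : V * V = 1
  isotony : ∀ P Q : DoubleCone, P ≤ Q → alg P ≤ alg Q
  grading : ∀ P : DoubleCone, ∀ x ∈ alg P, V * x * star V ∈ alg P
  even_comm : ∀ P Q : DoubleCone, SpacelikeRegions P.1 Q.1 → ∀ x ∈ alg P, ∀ y ∈ alg Q,
    V * x * star V = x → x * y = y * x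
  odd_anticomm : ∀ P Q : DoubleCone, SpacelikeRegions P.1 Q.1 → ∀ x ∈ alg P, ∀ y ∈ alg Q,
    V * x * star V = -x → V * y * star V = -y → x * y = -(y * x)

namespace GradedLocalNet

variable {H : Type*} [NormedAddCommGroup H] [InnerProductSpace ℂ H] [CompleteSpace H]

/-- The algebra of the spacelike complement of `P`, generated by the algebras of all
double cones contained in it. -/
noncomputable def complementAlgebra (F : GradedLocalNet H) (P : DoubleCone) : VonNeumannAlgebra H :=
  vnGenerated (⋃ Q ∈ {Q : DoubleCone | Q.1 ⊆ spacelikeComplement P.1},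
    (F.alg Q : Set (H →L[ℂ] H)))

/-- Twisted Haag duality: `F(P)ᵗ = F(P')'` for all double cones `P`. -/
def TwistedDuality (F : GradedLocalNet H) : Prop :=
  ∀ P : DoubleCone, twisted F.V (F.alg P) = ((F.complementAlgebra P).commutant : Set (H →L[ℂ] H))

/-- The split property for double cones: an interpolating type I factor exists. -/
def SplitProperty (F : GradedLocalNet H) : Prop :=
  ∀ P Q : DoubleCone, CompactlyInside P Q →
    ∃ N : VonNeumannAlgebra H, IsTypeIFactor N ∧ F.alg P ≤ N ∧ N ≤ F.alg Q

/-- All local algebras are factors. -/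
def LocalFactors (F : GradedLocalNet H) : Prop :=
  ∀ P : DoubleCone, IsFactor (F.alg P)

/-- Minimality of twisted relative commutants: `F(Q) ∧ F(P)ᵗ' = F(O₁) ∨ F(O₂)`. -/
def MinimalTwistedCommutants (F : GradedLocalNet H) : Prop :=
  ∀ P Q O₁ O₂ : DoubleCone, CompactlyInside P Q → AreComplementComponents P Q O₁ O₂ →
    (F.alg Q : Set (H →L[ℂ] H)) ∩ Set.centralizer (twisted F.V (F.alg P)) =
      (vnJoin (F.alg O₁) (F.alg O₂) : Set (H →L[ℂ] H))

/-- The restriction of `α₋` to every local algebra is an outer automorphism, i.e. it is not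
implemented by a unitary of the algebra. -/
def GradingOuter (F : GradedLocalNet H) : Prop :=
  ∀ P : DoubleCone, ¬ ∃ u ∈ F.alg P, u ∈ unitary (H →L[ℂ] H) ∧
    ∀ x ∈ F.alg P, F.V * x * star F.V = u * x * star u

/-- The pure Bose case: `α₋` acts trivially, so that all twists are trivial. -/
def PurelyBosonic (F : GradedLocalNet H) : Prop :=
  ∀ P : DoubleCone, ∀ x ∈ F.alg P, F.V * x * star F.V = x

end GradedLocalNet

end SolitonNet

/-! In the light-cone coordinates `t - x`, `t + x` two touching cones are rectangles with a common
corner, and the smallest cone `Q` around them is the spanned rectangle. Choose a smaller cone `P`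
inside `O₂` with the same corner. Then `P` is compactly inside `Q`, one component of `Q ∩ P'` is
exactly `O₁`, and the other, `O₃`, lies in `O₂`. Put `M = F(Q)`, `N = F(P)`, `R = M ∧ N'`. An even
element of `R` also commutes with the twisted `N`, so by minimality it lies in `F(O₁) ∨ F(O₃)`. It
remains to see that `N` and the even part of `R` generate `M`
(`IsTypeIFactor.mem_commutant_of_commute_even`).

With a type I factor `N ⊆ K ⊆ M` one has `R' ∧ N' = M'` (`IsTypeIFactor.mem_commutant_of_split`),
and hence `R` is a factor. If `R` is even, this suffices. Otherwise an `x` commuting with the even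
part of `R` has the form `a + bV` with `a, b ∈ R'` (`exists_add_mul_of_commute_even`), uniquely,
since `R` has a nonzero odd element. If `x` also commutes with `N`, uniqueness makes `b` an
intertwiner between the identity and `Ad V` on `N`. Slicing `b` over `K` gives such intertwiners
inside `N`, which vanish because the grading is outer. So `b = 0` and `x = a ∈ R' ∧ N' = M'`.

Type I factors are handled without tensor products: operators on a corner are extended to a
commutant (`exists_commutant_extension`), which provides the slice maps. -/

namespace SolitonNet

/-! ### Extension of corner operators to commutants, and factors -/

section OperatorAlgebras

variable {H : Type*} [NormedAddCommGroup H] [InnerProductSpace ℂ H] [CompleteSpace H]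

-- This bound makes `r P k ↦ r a k` well defined and continuous. Taking adjoints in `h` shows that
-- `a*a` commutes with `P R P`, so the square root `D` of `‖a‖² - a*a` does too. The map `g` built
-- from `D P` is the missing part: `‖g x‖² + ‖f x‖² = ‖a‖² ‖e x‖²`.
open scoped InnerProductSpace in
theorem norm_finsupp_lsum_le (R : StarSubalgebra ℂ (H →L[ℂ] H)) (P a : H →L[ℂ] H)
    (hP : star P = P) (hPP : P * P = P) (ha : a * P = a)
    (h : ∀ r ∈ R, star a * r * a = P * r * P * (star a * a)) (x : R →₀ H) :
    ‖Finsupp.lsum ℂ (fun r : R => ((r.1 * a : H →L[ℂ] H) : H →ₗ[ℂ] H)) x‖ ≤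
      ‖a‖ * ‖Finsupp.lsum ℂ (fun r : R => ((r.1 * P : H →L[ℂ] H) : H →ₗ[ℂ] H)) x‖ := by
  set e := Finsupp.lsum ℂ (fun r : R => ((r.1 * P : H →L[ℂ] H) : H →ₗ[ℂ] H)) with he
  set f := Finsupp.lsum ℂ (fun r : R => ((r.1 * a : H →L[ℂ] H) : H →ₗ[ℂ] H)) with hf
  have hPa : P * star a = star a := by
    have := congrArg star ha
    rwa [star_mul, hP] at this
  have hcomm : ∀ r ∈ R, Commute (star a * a) (P * r * P) := by
    intro r hr
    have h1 := congrArg star (h (star r) (star_mem hr))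
    simp only [star_mul, star_star, hP] at h1
    have h2 := h r hr
    rw [Commute, SemiconjBy]
    rw [← h2, mul_assoc (star a) r a, h1]
    simp only [mul_assoc]
  set Q : H →L[ℂ] H := algebraMap ℝ (H →L[ℂ] H) (‖a‖ ^ 2) - star a * a with hQ
  have hQ0 : 0 ≤ Q := sub_nonneg.2 CStarAlgebra.star_mul_le_algebraMap_norm_sq
  set D := CFC.sqrt Q with hD
  have hDD : D * D = Q := CFC.sqrt_mul_sqrt_self Q hQ0
  have hDs : star D = D := (CFC.sqrt_nonneg Q).isSelfAdjoint.star_eq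
  have hDc : ∀ r ∈ R, D * (P * r * P) = (P * r * P) * D := by
    intro r hr
    have : Commute Q (P * r * P) := by
      refine Commute.sub_left ?_ (hcomm r hr)
      exact Algebra.commutes _ _
    exact this.cfcₙ_nnreal _
  have hDP : D * P = P * D := by
    have := hDc 1 (one_mem R)
    rwa [mul_one, hPP] at this
  set g := Finsupp.lsum ℂ (fun r : R => ((r.1 * (D * P) : H →L[ℂ] H) : H →ₗ[ℂ] H)) with hg
  have hop : ∀ r ∈ R, star (D * P) * r * (D * P) + star a * r * a =
      ((‖a‖ ^ 2 : ℝ) : ℂ) • (P * r * P) := by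
    intro r hr
    rw [h r hr]
    have h1 : star (D * P) * r * (D * P) = P * r * P * Q := by
      rw [star_mul, hDs, hP, ← hDP]
      calc D * P * r * (D * P) = D * P * r * (P * D) := by rw [hDP]
        _ = (D * (P * r * P)) * D := by simp only [mul_assoc]
        _ = P * r * P * (D * D) := by rw [hDc r hr, mul_assoc]
        _ = _ := by rw [hDD]
    rw [h1, ← mul_add, hQ, sub_add_cancel, Algebra.algebraMap_eq_smul_one,
      mul_smul_comm, mul_one]
    exact RCLike.real_smul_eq_coe_smul (K := ℂ) _ _
  have key : ∀ x y : R →₀ H, ⟪g x, g y⟫_ℂ + ⟪f x, f y⟫_ℂ =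
      ((‖a‖ ^ 2 : ℝ) : ℂ) * ⟪e x, e y⟫_ℂ := by
    intro x y
    induction x using Finsupp.induction_linear with
    | zero => simp
    | add x₁ x₂ h₁ h₂ =>
      simp only [map_add, inner_add_left]
      linear_combination h₁ + h₂
    | single r h =>
      induction y using Finsupp.induction_linear with
      | zero => simp
      | add y₁ y₂ h₁ h₂ =>
        simp only [map_add, inner_add_right]
        linear_combination h₁ + h₂
      | single s k =>
        have := congrArg (fun T : H →L[ℂ] H => ⟪h, T k⟫_ℂ)
          (hop (star r.1 * s.1) (mul_mem (star_mem r.2) s.2))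
        simp only [add_apply, mul_apply_eq_comp,
          smul_apply, inner_add_right, inner_smul_right,
          ContinuousLinearMap.star_eq_adjoint, ContinuousLinearMap.adjoint_inner_right] at this
        have hPi : ∀ u v : H, ⟪u, P v⟫_ℂ = ⟪P u, v⟫_ℂ := by
          intro u v
          rw [← ContinuousLinearMap.adjoint_inner_right, ← ContinuousLinearMap.star_eq_adjoint, hP]
        rw [hPi, ContinuousLinearMap.adjoint_inner_right] at this
        simpa [he, hf, hg] using this
  have hx := key x x
  rw [inner_self_eq_norm_sq_to_K, inner_self_eq_norm_sq_to_K, inner_self_eq_norm_sq_to_K] at hx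
  have hx' : ‖g x‖ ^ 2 + ‖f x‖ ^ 2 = ‖a‖ ^ 2 * ‖e x‖ ^ 2 := by
    apply Complex.ofReal_injective
    push_cast
    push_cast at hx
    exact hx
  refine le_of_sq_le_sq ?_ (by positivity)
  rw [mul_pow, ← hx']
  nlinarith [sq_nonneg ‖g x‖]

/-- An operator `a = a P` whose corner behaves like an intertwiner for `P R P` extends to an
element of the commutant of `R`. -/
theorem exists_commutant_extension (R : StarSubalgebra ℂ (H →L[ℂ] H)) (P a : H →L[ℂ] H)
    (hP : star P = P) (hPP : P * P = P) (ha : a * P = a)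
    (h : ∀ r ∈ R, star a * r * a = P * r * P * (star a * a)) :
    ∃ t : H →L[ℂ] H, (∀ r ∈ R, r * t = t * r) ∧ t * P = a ∧
      ∀ y : H →L[ℂ] H, (∀ r ∈ R, r * y = y * r) → y * P = P * y → y * a = a * y →
        y * t = t * y := by
  set e := Finsupp.lsum ℂ (fun r : R => ((r.1 * P : H →L[ℂ] H) : H →ₗ[ℂ] H)) with he
  set f := Finsupp.lsum ℂ (fun r : R => ((r.1 * a : H →L[ℂ] H) : H →ₗ[ℂ] H)) with hf
  have hbound : ∀ x, ‖f x‖ ≤ ‖a‖ * ‖e x‖ := norm_finsupp_lsum_le R P a hP hPP ha h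
  set F : Submodule ℂ H := (LinearMap.range e).topologicalClosure with hF
  have hFc : IsClosed (F : Set H) := Submodule.isClosed_topologicalClosure _
  have : CompleteSpace F := hFc.completeSpace_coe
  have heF : ∀ x, e x ∈ F := fun x => Submodule.le_topologicalClosure _ (LinearMap.mem_range_self e x)
  set e' : (R →₀ H) →ₗ[ℂ] F := e.codRestrict F heF with he'
  have hdense : DenseRange e' := by
    intro v
    rw [closure_subtype]
    have : (Subtype.val '' Set.range e') = (LinearMap.range e : Set H) := by
      ext w
      constructor
      · rintro ⟨_, ⟨x, rfl⟩, rfl⟩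
        exact ⟨x, rfl⟩
      · rintro ⟨x, rfl⟩
        exact ⟨_, ⟨x, rfl⟩, rfl⟩
    rw [this]
    exact v.2
  -- On the closure `F` of `R P H` this is the extension of `r P k ↦ r a k`; on the orthogonal
  -- complement it is zero.
  set t : H →L[ℂ] H := (f.extendOfNorm e').comp F.orthogonalProjectionOnto with ht
  have hte : ∀ x, t (e x) = f x := by
    intro x
    have h1 : F.orthogonalProjectionOnto (e x) = e' x :=
      Submodule.orthogonalProjectionOnto_mem_subspace_eq_self (K := F) (e' x)
    rw [ht, ContinuousLinearMap.comp_apply, h1]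
    exact LinearMap.extendOfNorm_eq hdense ⟨‖a‖, hbound⟩ x
  have ht0 : ∀ v ∈ Fᗮ, t v = 0 := by
    intro v hv
    rw [ht, ContinuousLinearMap.comp_apply,
      Submodule.orthogonalProjectionOnto_apply_of_mem_orthogonal hv, map_zero]
  have htr : ∀ s ∈ R, ∀ k : H, t (s (P k)) = s (a k) := by
    intro s hs k
    simpa [he, hf] using hte (Finsupp.single ⟨s, hs⟩ k)
  have hmemF : ∀ s ∈ R, ∀ k : H, s (P k) ∈ F := by
    intro s hs k
    simpa [he] using heF (Finsupp.single ⟨s, hs⟩ k)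
  have hind : ∀ p : H → Prop, IsClosed {v | p v} → p 0 → (∀ v w, p v → p w → p (v + w)) →
      (∀ s ∈ R, ∀ k, p (s (P k))) → ∀ v ∈ F, p v := by
    intro p hc h0 hadd hs v hv
    refine closure_minimal (s := (LinearMap.range e : Set H)) ?_ hc hv
    rintro _ ⟨x, rfl⟩
    induction x using Finsupp.induction_linear with
    | zero => simpa using h0
    | add x y hx hy => rw [map_add]; exact hadd _ _ hx hy
    | single s k => simpa [he] using hs s.1 s.2 k
  have hcommute : ∀ y : H →L[ℂ] H,
      (∀ s ∈ R, ∀ k, ∃ s' ∈ R, ∃ k', y (s (P k)) = s' (P k') ∧ y (s (a k)) = s' (a k')) →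
      (∀ s ∈ R, ∀ k, ∃ s' ∈ R, ∃ k', star y (s (P k)) = s' (P k')) → y * t = t * y := by
    intro y h1 h2
    have hFF : ∀ v ∈ F, y (t v) = t (y v) := by
      refine hind _ (isClosed_eq (by fun_prop) (by fun_prop)) (by simp) ?_ ?_
      · intro v w hv hw
        simp only [map_add, hv, hw]
      · intro s hs k
        obtain ⟨s', hs', k', e1, e2⟩ := h1 s hs k
        rw [e1, htr s hs, htr s' hs', e2]
    have hys : ∀ v ∈ F, star y v ∈ F := by
      refine hind _ (hFc.preimage (star y).continuous) (by simp) ?_ ?_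
      · intro v w hv hw
        rw [map_add]
        exact add_mem hv hw
      · intro s hs k
        obtain ⟨s', hs', k', e1⟩ := h2 s hs k
        rw [e1]
        exact hmemF s' hs' k'
    have hyo : ∀ v ∈ Fᗮ, y v ∈ Fᗮ := by
      intro v hv
      rw [Submodule.mem_orthogonal] at hv ⊢
      intro u hu
      rw [← ContinuousLinearMap.adjoint_inner_left, ← ContinuousLinearMap.star_eq_adjoint]
      exact hv _ (hys u hu)
    ext v
    obtain ⟨v₁, hv₁, v₂, hv₂, rfl⟩ := F.exists_add_mem_mem_orthogonal v
    simp only [mul_apply_eq_comp, map_add]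
    rw [hFF _ hv₁, ht0 _ hv₂, ht0 _ (hyo _ hv₂), map_zero]
  refine ⟨t, ?_, ?_, ?_⟩
  · intro r hr
    apply hcommute
    · intro s hs k
      exact ⟨r * s, mul_mem hr hs, k, rfl, rfl⟩
    · intro s hs k
      exact ⟨star r * s, mul_mem (star_mem hr) hs, k, rfl⟩
  · ext k
    simpa using htr 1 (one_mem R) k
  · intro y hyR hyP hya
    have app : ∀ {S T U W : H →L[ℂ] H}, S * T = U * W → ∀ k, S (T k) = U (W k) :=
      fun h k => congrArg (fun T : H →L[ℂ] H => T k) h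
    have hysR : ∀ r ∈ R, star y * r = r * star y := by
      intro r hr
      have := congrArg star (hyR (star r) (star_mem hr))
      simpa using this
    have hysP : star y * P = P * star y := by
      have := congrArg star hyP
      simpa [hP] using this.symm
    apply hcommute
    · intro s hs k
      refine ⟨s, hs, y k, ?_, ?_⟩
      · rw [← app (hyR s hs), app hyP]
      · rw [← app (hyR s hs), app hya]
    · intro s hs k
      exact ⟨s, hs, star y k, by rw [app (hysR s hs), app hysP]⟩

/-- The closed span of `M s H` is invariant under `M` and, as `s ∈ M`, under `M'`. Its projection is
therefore central, hence `1`, while `d` vanishes on that span. -/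
theorem IsFactor.eq_zero_of_mul_mul {M : VonNeumannAlgebra H} (hM : IsFactor M)
    {s d : H →L[ℂ] H} (hs : s ∈ M) (hs0 : s ≠ 0) (h : ∀ r ∈ M, d * r * s = 0) : d = 0 := by
  set F : Submodule ℂ H :=
    (Submodule.span ℂ {v | ∃ r ∈ M, ∃ k, v = r (s k)}).topologicalClosure with hF
  have hFc : IsClosed (F : Set H) := Submodule.isClosed_topologicalClosure _
  have : CompleteSpace F := hFc.completeSpace_coe
  have hgen : ∀ r ∈ M, ∀ k, r (s k) ∈ F := fun r hr k =>
    Submodule.le_topologicalClosure _ (Submodule.subset_span ⟨r, hr, k, rfl⟩)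
  have hle : ∀ G : Submodule ℂ H, IsClosed (G : Set H) → (∀ r ∈ M, ∀ k, r (s k) ∈ G) → F ≤ G := by
    intro G hG hr
    refine Submodule.topologicalClosure_minimal _ (Submodule.span_le.2 ?_) hG
    rintro _ ⟨r, hr', k, rfl⟩
    exact hr r hr' k
  set p := F.starProjection with hp
  have hpp : IsStarProjection p := isStarProjection_starProjection
  have hrange : p.range = F := Submodule.range_starProjection F
  have hinv : ∀ y : H →L[ℂ] H, (∀ r ∈ M, ∀ k, y (r (s k)) ∈ F) →
      p.range ∈ Module.End.invtSubmodule y := by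
    intro y hy
    rw [hrange]
    exact hle (F.comap (y : H →ₗ[ℂ] H)) (hFc.preimage y.continuous) hy
  have hp1 : p ∈ M := by
    rw [VonNeumannAlgebra.IsStarProjection.mem_iff hpp]
    intro y hy
    apply hinv
    intro r hr k
    rw [VonNeumannAlgebra.mem_commutant_iff] at hy
    have : y * (r * s) = r * s * y := (hy _ (mul_mem hr hs)).symm
    have := congrArg (fun T : H →L[ℂ] H => T k) this
    simp only [mul_apply_eq_comp] at this
    rw [this]
    exact hgen r hr _
  have hp2 : p ∈ M.commutant := by
    rw [VonNeumannAlgebra.IsStarProjection.mem_iff hpp]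
    intro y hy
    rw [VonNeumannAlgebra.commutant_commutant] at hy
    apply hinv
    intro r hr k
    exact hgen (y * r) (mul_mem hy hr) k
  obtain ⟨c, hc⟩ := hM p hp1 hp2
  obtain ⟨k, hk⟩ : ∃ k, s k ≠ 0 := by
    by_contra! hcon
    exact hs0 (ContinuousLinearMap.ext hcon)
  have hpk : p (s k) = s k := Submodule.starProjection_eq_self_iff.2 (hgen 1 (one_mem M) k)
  have hc1 : c = 1 := by
    rw [hc] at hpk
    have : (c - 1) • s k = 0 := by
      rw [sub_smul, one_smul, sub_eq_zero]
      simpa using hpk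
    rcases smul_eq_zero.1 this with h | h
    · exact sub_eq_zero.1 h
    · exact absurd h hk
  rw [hc1, one_smul] at hc
  have hker : F ≤ LinearMap.ker (d : H →ₗ[ℂ] H) := by
    refine hle _ (ContinuousLinearMap.isClosed_ker d) ?_
    intro r hr k
    exact congrArg (fun T : H →L[ℂ] H => T k) (h r hr)
  ext v
  have hv : v ∈ F := by
    rw [← Submodule.starProjection_eq_self_iff, ← hp, hc]
    rfl
  exact hker hv

theorem IsFactor.commutant {M : VonNeumannAlgebra H} (hM : IsFactor M) : IsFactor M.commutant := by
  intro z h1 h2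
  rw [VonNeumannAlgebra.commutant_commutant] at h2
  exact hM z h2 h1

/-- The corners `q k b l q` act as matrix coefficients of `b`, so operator identities can be tested
on them. The previous kind of argument is used twice, the second time for the adjoint. -/
theorem IsFactor.eq_zero_of_corners {M : VonNeumannAlgebra H} (hM : IsFactor M)
    {q b : H →L[ℂ] H} (hq : q ∈ M) (hqs : star q = q) (hq0 : q ≠ 0)
    (h : ∀ k ∈ M, ∀ l ∈ M, q * k * b * l * q = 0) : b = 0 := by
  have h1 : ∀ k ∈ M, q * k * b = 0 := fun k hk => hM.eq_zero_of_mul_mul hq hq0 (h k hk)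
  have h2 : star b = 0 := by
    refine hM.eq_zero_of_mul_mul hq hq0 ?_
    intro r hr
    have := congrArg star (h1 (star r) (star_mem hr))
    simpa [hqs, mul_assoc] using this
  simpa using h2

/-! ### Minimal projections -/

/-- A minimal projection of a von Neumann algebra. -/
structure IsMinimalProjection (M : VonNeumannAlgebra H) (p : H →L[ℂ] H) : Prop where
  mem : p ∈ M
  star_eq : star p = p
  mul_self : p * p = p
  ne_zero : p ≠ 0
  corner : ∀ x ∈ M, ∃ c : ℂ, p * x * p = c • p

/-- Minimality makes `q r q` a scalar multiple of `q`, so the extension criterion holds for every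
operator `c` on the corner: the compression of `M'` to `q H` is all of `B(q H)`. -/
theorem IsMinimalProjection.exists_extension {M : VonNeumannAlgebra H} {q c : H →L[ℂ] H}
    (hq : IsMinimalProjection M q) (h1 : q * c = c) (h2 : c * q = c) :
    ∃ t ∈ M.commutant, t * q = c ∧ ∀ y ∈ M.commutant, y * c = c * y → y * t = t * y := by
  have h3 : star c * q = star c := by
    have := congrArg star h1
    rwa [star_mul, hq.star_eq] at this
  obtain ⟨t, ht1, ht2, ht3⟩ := exists_commutant_extension M.toStarSubalgebra q c hq.star_eq
    hq.mul_self h2 (by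
      intro r hr
      obtain ⟨l, hl⟩ := hq.corner r hr
      have h4 : q * (star c * c) = star c * c := by
        rw [← mul_assoc]
        congr 1
        have := congrArg star h2
        rwa [star_mul, hq.star_eq] at this
      calc star c * r * c = (star c * q) * r * (q * c) := by rw [h1, h3]
        _ = star c * (q * r * q) * c := by simp only [mul_assoc]
        _ = l • (star c * q * c) := by rw [hl]; simp
        _ = l • (q * (star c * c)) := by rw [h3, h4]
        _ = q * r * q * (star c * c) := by rw [hl]; simp)
  refine ⟨t, VonNeumannAlgebra.mem_commutant_iff.2 ht1, ht2, ?_⟩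
  intro y hy hyc
  rw [VonNeumannAlgebra.mem_commutant_iff] at hy
  exact ht3 y hy (hy q hq.mem).symm hyc

theorem IsFactor.eq_zero_of_mul_eq_zero {M : VonNeumannAlgebra H} (hM : IsFactor M)
    {s d : H →L[ℂ] H} (hs : s ∈ M) (hs0 : s ≠ 0) (hd : d ∈ M.commutant) (h : d * s = 0) :
    d = 0 := by
  refine hM.eq_zero_of_mul_mul hs hs0 ?_
  intro r hr
  rw [← VonNeumannAlgebra.mem_commutant_iff.1 hd r hr, mul_assoc, h, mul_zero]

open scoped InnerProductSpace in
/-- The commutant of a type I factor contains a minimal projection. -/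
theorem IsMinimalProjection.exists_commutant {K : VonNeumannAlgebra H} {p : H →L[ℂ] H}
    (hK : IsFactor K) (hp : IsMinimalProjection K p) :
    ∃ q, IsMinimalProjection K.commutant q := by
  obtain ⟨v, hv⟩ : ∃ v, p v ≠ 0 := by
    by_contra! hcon
    exact hp.ne_zero (ContinuousLinearMap.ext hcon)
  obtain ⟨w, hw1, hw⟩ : ∃ w : H, ‖w‖ = 1 ∧ p w = w := by
    refine ⟨((‖p v‖ : ℂ)⁻¹) • p v, ?_, ?_⟩
    · rw [norm_smul, norm_inv, Complex.norm_real, norm_norm, inv_mul_cancel₀ (norm_ne_zero_iff.2 hv)]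
    · have : p (p v) = p v := congrArg (fun T : H →L[ℂ] H => T v) hp.mul_self
      rw [map_smul, this]
  set a : H →L[ℂ] H := InnerProductSpace.rankOne ℂ w w with ha
  have haa : ∀ x, a x = ⟪w, x⟫_ℂ • w := fun x => by simp [ha]
  have hww : ⟪w, w⟫_ℂ = 1 := by rw [inner_self_eq_norm_sq_to_K, hw1]; simp
  have hpi : ∀ x, ⟪w, p x⟫_ℂ = ⟪w, x⟫_ℂ := by
    intro x
    rw [← ContinuousLinearMap.adjoint_inner_left, ← ContinuousLinearMap.star_eq_adjoint,
      hp.star_eq, hw]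
  have h1 : p * a = a := by
    ext x; simp [haa, hw]
  have h2 : a * p = a := by
    ext x; simp [haa, hpi]
  have has : star a = a := by
    have := congrArg (fun T => T) (InnerProductSpace.adjoint_rankOne (𝕜 := ℂ) w w)
    rw [ContinuousLinearMap.star_eq_adjoint]
    exact this
  have hak : ∀ k : H →L[ℂ] H, a * k * a = ⟪w, k w⟫_ℂ • a := by
    intro k
    ext x
    simp [haa, smul_smul, mul_comm]
  have hsq : a * a = a := by
    have := hak 1
    rwa [mul_one, one_apply_eq_self, hww, one_smul] at this
  have ha0 : a ≠ 0 := by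
    intro h0
    have := haa w
    rw [h0, hww, one_smul] at this
    rw [← this] at hw1
    simp at hw1
  -- A rank-one projection below `p` is minimal in `B(p H)`. Its properties pass to `q` because `k ↦
  -- k p` is injective on `K'`.
  obtain ⟨q, hq, hqp, -⟩ := hp.exists_extension h1 h2
  have hpc : ∀ k ∈ K.commutant, p * k = k * p := fun k hk =>
    VonNeumannAlgebra.mem_commutant_iff.1 hk p hp.mem
  have huniq : ∀ k ∈ K.commutant, ∀ l ∈ K.commutant, k * p = l * p → k = l := by
    intro k hk l hl hkl
    rw [← sub_eq_zero]
    exact hK.eq_zero_of_mul_eq_zero hp.mem hp.ne_zero (sub_mem hk hl)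
      (by rw [sub_mul, hkl, sub_self])
  refine ⟨q, hq, ?_, ?_, ?_, ?_⟩
  · apply huniq _ (star_mem hq) _ hq
    rw [hqp, ← hpc _ (star_mem hq)]
    have := congrArg star hqp
    rwa [star_mul, hp.star_eq, has] at this
  · apply huniq _ (mul_mem hq hq) _ hq
    rw [mul_assoc, hqp, ← h1, ← mul_assoc, hqp, hsq, h1]
  · rintro rfl
    exact ha0 (by rw [← hqp, zero_mul])
  · intro k hk
    refine ⟨⟪w, k w⟫_ℂ, ?_⟩
    have hsm : ⟪w, k w⟫_ℂ • q ∈ K.commutant :=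
      (K.commutant.toStarSubalgebra).smul_mem hq _
    apply huniq _ (mul_mem (mul_mem hq hk) hq) _ hsm
    rw [mul_assoc, hqp, smul_mul_assoc, hqp, ← hak, ← hqp, hqp]
    calc q * k * a = q * k * (p * a) := by rw [h1]
      _ = q * (k * p) * a := by simp only [mul_assoc]
      _ = q * p * k * a := by rw [← hpc k hk]; simp only [mul_assoc]
      _ = _ := by rw [hqp]

end OperatorAlgebras

end SolitonNet

namespace SolitonNet

/-! ### Joins, relative commutants and slices over a type I factor -/

section SplitInclusions

variable {H : Type*} [NormedAddCommGroup H] [InnerProductSpace ℂ H] [CompleteSpace H]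

theorem commutant_le_commutant {M N : VonNeumannAlgebra H} (h : M ≤ N) :
    N.commutant ≤ M.commutant := by
  intro x hx
  rw [VonNeumannAlgebra.mem_commutant_iff] at hx ⊢
  exact fun g hg => hx g (h hg)

theorem mem_of_commute_commutant {M : VonNeumannAlgebra H} {x : H →L[ℂ] H}
    (h : ∀ y ∈ M.commutant, y * x = x * y) : x ∈ M := by
  rw [← M.commutant_commutant, VonNeumannAlgebra.mem_commutant_iff]
  exact h

theorem smul_mem_vonNeumann (M : VonNeumannAlgebra H) (c : ℂ) {x : H →L[ℂ] H} (hx : x ∈ M) :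
    c • x ∈ M :=
  M.toStarSubalgebra.smul_mem hx c

theorem le_vnJoin_left (M N : VonNeumannAlgebra H) : M ≤ vnJoin M N := fun _ hx =>
  (vnGenerated_le_iff _ _).1 le_rfl (Or.inl hx)

theorem le_vnJoin_right (M N : VonNeumannAlgebra H) : N ≤ vnJoin M N := fun _ hx =>
  (vnGenerated_le_iff _ _).1 le_rfl (Or.inr hx)

theorem vnJoin_le {M N L : VonNeumannAlgebra H} (hM : M ≤ L) (hN : N ≤ L) : vnJoin M N ≤ L := by
  refine (vnGenerated_le_iff _ _).2 ?_
  rintro x (hx | hx)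
  · exact hM hx
  · exact hN hx

theorem vnJoin_comm (M N : VonNeumannAlgebra H) : vnJoin M N = vnJoin N M :=
  le_antisymm (vnJoin_le (le_vnJoin_right _ _) (le_vnJoin_left _ _))
    (vnJoin_le (le_vnJoin_right _ _) (le_vnJoin_left _ _))

theorem mem_commutant_vnJoin {M N : VonNeumannAlgebra H} {x : H →L[ℂ] H} :
    x ∈ (vnJoin M N).commutant ↔ x ∈ M.commutant ∧ x ∈ N.commutant := by
  constructor
  · intro h
    exact ⟨commutant_le_commutant (le_vnJoin_left M N) h,
      commutant_le_commutant (le_vnJoin_right M N) h⟩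
  · rintro ⟨h1, h2⟩
    have key : ∀ L : VonNeumannAlgebra H, x ∈ L.commutant →
        L ≤ (vnGenerated {x}).commutant := by
      intro L hL y hy
      rw [VonNeumannAlgebra.mem_commutant_iff]
      intro g hg
      have : g ∈ L.commutant :=
        (vnGenerated_le_iff {x} L.commutant).2 (Set.singleton_subset_iff.2 hL) hg
      exact (VonNeumannAlgebra.mem_commutant_iff.1 this y hy).symm
    rw [VonNeumannAlgebra.mem_commutant_iff]
    intro g hg
    have := VonNeumannAlgebra.mem_commutant_iff.1 (vnJoin_le (key M h1) (key N h2) hg) x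
      ((vnGenerated_le_iff {x} _).1 le_rfl rfl)
    exact this.symm

/-- The relative commutant `M ∧ N'`. -/
noncomputable def relativeCommutant (M N : VonNeumannAlgebra H) : VonNeumannAlgebra H :=
  (vnJoin M.commutant N).commutant

theorem mem_relativeCommutant {M N : VonNeumannAlgebra H} {x : H →L[ℂ] H} :
    x ∈ relativeCommutant M N ↔ x ∈ M ∧ x ∈ N.commutant := by
  rw [relativeCommutant, mem_commutant_vnJoin, VonNeumannAlgebra.commutant_commutant]

theorem relativeCommutant_mono {K M : VonNeumannAlgebra H} (h : K ≤ M) (N : VonNeumannAlgebra H) :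
    relativeCommutant K N ≤ relativeCommutant M N := by
  intro x hx
  rw [mem_relativeCommutant] at hx ⊢
  exact ⟨h hx.1, hx.2⟩

theorem corner_commute {K : VonNeumannAlgebra H} {q y k b l : H →L[ℂ] H} (hq : q ∈ K.commutant)
    (hk : k ∈ K.commutant) (hl : l ∈ K.commutant) (hy : y ∈ K) :
    y * (q * k * b * l * q) = q * k * (y * b) * l * q ∧
      q * k * b * l * q * y = q * k * (b * y) * l * q := by
  rw [VonNeumannAlgebra.mem_commutant_iff] at hq hk hl
  constructor
  · calc y * (q * k * b * l * q) = y * q * k * b * l * q := by simp only [mul_assoc]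
      _ = q * (y * k) * b * l * q := by rw [hq y hy]; simp only [mul_assoc]
      _ = _ := by rw [hk y hy]; simp only [mul_assoc]
  · calc q * k * b * l * q * y = q * k * b * l * (q * y) := by simp only [mul_assoc]
      _ = q * k * b * (l * y) * q := by rw [← hq y hy]; simp only [mul_assoc]
      _ = _ := by rw [← hl y hy]; simp only [mul_assoc]

/-- The element `t` is a slice of `b`: compression by `q` identifies `K` with `B(q H)`, and `q k b l
q` is an operator on `q H`. -/
theorem IsMinimalProjection.exists_corner_extension {K : VonNeumannAlgebra H} {q : H →L[ℂ] H}
    (hq : IsMinimalProjection K.commutant q) (k b l : H →L[ℂ] H) :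
    ∃ t ∈ K, t * q = q * k * b * l * q ∧
      ∀ y ∈ K, y * (q * k * b * l * q) = q * k * b * l * q * y → y * t = t * y := by
  have := hq.exists_extension (c := q * k * b * l * q)
    (by simp only [← mul_assoc, hq.mul_self]) (by rw [mul_assoc, hq.mul_self])
  rwa [VonNeumannAlgebra.commutant_commutant] at this

theorem IsFactor.eq_of_mul_commutant {K : VonNeumannAlgebra H} (hK : IsFactor K)
    {q s t : H →L[ℂ] H} (hq : IsMinimalProjection K.commutant q) (hs : s ∈ K) (ht : t ∈ K)
    (h : s * q = t * q) : s = t := by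
  rw [← sub_eq_zero]
  refine hK.commutant.eq_zero_of_mul_eq_zero hq.mem hq.ne_zero ?_ (by rw [sub_mul, h, sub_self])
  rw [VonNeumannAlgebra.commutant_commutant]
  exact sub_mem hs ht

/-- Slices of operators commuting with `K ∧ N'` lie in `N`. -/
theorem exists_slice {K N : VonNeumannAlgebra H} {q b : H →L[ℂ] H} (hK : IsFactor K)
    (hNK : N ≤ K) (hq : IsMinimalProjection K.commutant q)
    (hb : b ∈ (relativeCommutant K N).commutant) {k l : H →L[ℂ] H}
    (hk : k ∈ K.commutant) (hl : l ∈ K.commutant) :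
    ∃ t ∈ N, t * q = q * k * b * l * q := by
  obtain ⟨t, htK, htq, htc⟩ := hq.exists_corner_extension k b l
  refine ⟨t, ?_, htq⟩
  apply mem_of_commute_commutant
  intro y hy
  rw [← sub_eq_zero]
  -- The commutator of `y ∈ N'` with `t` is tested on corners. The slices `s` of `y` lie in `K ∧
  -- N'`, so they commute with `b` and hence with its slice `t`.
  refine hK.commutant.eq_zero_of_corners hq.mem hq.star_eq hq.ne_zero ?_
  intro k' hk' l' hl'
  obtain ⟨s, hsK, hsq, hsc⟩ := hq.exists_corner_extension k' y l'
  have hsN : s ∈ relativeCommutant K N := by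
    rw [mem_relativeCommutant]
    refine ⟨hsK, VonNeumannAlgebra.mem_commutant_iff.2 fun n hn => hsc n (hNK hn) ?_⟩
    obtain ⟨e1, e2⟩ := corner_commute (b := y) hq.mem hk' hl' (hNK hn)
    rw [e1, e2, VonNeumannAlgebra.mem_commutant_iff.1 hy n hn]
  have hst : s * t = t * s := by
    refine htc s hsK ?_
    obtain ⟨e1, e2⟩ := corner_commute (b := b) hq.mem hk hl hsK
    rw [e1, e2, VonNeumannAlgebra.mem_commutant_iff.1 hb s hsN]
  obtain ⟨e1, e2⟩ := corner_commute (b := y) hq.mem hk' hl' htK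
  have hqt := VonNeumannAlgebra.mem_commutant_iff.1 hq.mem t htK
  rw [mul_sub, sub_mul, sub_mul, ← e1, ← e2, ← hsq, mul_assoc s q t, ← hqt, ← mul_assoc,
    ← mul_assoc, hst, sub_self]

theorem IsTypeIFactor.exists_minimalProjection {K : VonNeumannAlgebra H} (hK : IsTypeIFactor K) :
    ∃ p, IsMinimalProjection K p := by
  obtain ⟨-, p, hp, hpp, hp0, hpc⟩ := hK
  exact ⟨p, hp, hpp.isSelfAdjoint.star_eq, hpp.isIdempotentElem, hp0, hpc⟩

/-- If a factor `N` is split in `M`, then `(M' ∨ N) ∧ N' = M'`. -/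
theorem IsTypeIFactor.mem_commutant_of_split {K M N : VonNeumannAlgebra H} (hK : IsTypeIFactor K)
    (hNK : N ≤ K) (hKM : K ≤ M) (hN : IsFactor N) {b : H →L[ℂ] H}
    (hb : b ∈ (relativeCommutant M N).commutant) (hbN : b ∈ N.commutant) : b ∈ M.commutant := by
  obtain ⟨p, hp⟩ := hK.exists_minimalProjection
  obtain ⟨q, hq⟩ := hp.exists_commutant hK.1
  have hb' := commutant_le_commutant (relativeCommutant_mono hKM N) hb
  -- Slices of `b` lie in `N` and, since `b` commutes with `N`, also in `N'`. They are scalars, so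
  -- `b` commutes with `K`.
  have hbK : b ∈ K.commutant := by
    rw [VonNeumannAlgebra.mem_commutant_iff]
    intro x hx
    rw [← sub_eq_zero]
    refine hK.1.commutant.eq_zero_of_corners hq.mem hq.star_eq hq.ne_zero ?_
    intro k hk l hl
    obtain ⟨t, htN, htq⟩ := exists_slice hK.1 hNK hq hb' hk hl
    have htN' : t ∈ N.commutant := by
      rw [VonNeumannAlgebra.mem_commutant_iff]
      intro n hn
      apply hK.1.eq_of_mul_commutant hq (mul_mem (hNK hn) (hNK htN)) (mul_mem (hNK htN) (hNK hn))
      obtain ⟨e1, e2⟩ := corner_commute (b := b) hq.mem hk hl (hNK hn)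
      rw [mul_assoc, htq, e1, mul_assoc t n q, VonNeumannAlgebra.mem_commutant_iff.1 hq.mem n (hNK hn),
        ← mul_assoc t q, htq, e2, VonNeumannAlgebra.mem_commutant_iff.1 hbN n hn]
    obtain ⟨c, hc⟩ := hN t htN htN'
    obtain ⟨e1, e2⟩ := corner_commute (b := b) hq.mem hk hl hx
    rw [mul_sub, sub_mul, sub_mul, ← e1, ← e2, ← htq, hc]
    simp [VonNeumannAlgebra.mem_commutant_iff.1 hq.mem x hx]
  -- Now the roles of `K` and `K'` are exchanged: slices of `y ∈ M` taken with `p ∈ K` lie in `M ∧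
  -- K'`, which is contained in `M ∧ N'`, so they commute with `b`.
  rw [VonNeumannAlgebra.mem_commutant_iff]
  intro y hy
  rw [← sub_eq_zero]
  refine hK.1.eq_zero_of_corners hp.mem hp.star_eq hp.ne_zero ?_
  intro k hk l hl
  obtain ⟨s, hsK, hsp, hsc⟩ := hp.exists_extension (c := p * k * y * l * p)
    (by simp only [← mul_assoc, hp.mul_self]) (by rw [mul_assoc, hp.mul_self])
  have hsR : s ∈ relativeCommutant M N := by
    refine mem_relativeCommutant.2 ⟨?_, commutant_le_commutant hNK hsK⟩
    apply mem_of_commute_commutant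
    intro z hz
    refine hsc z (commutant_le_commutant hKM hz) ?_
    refine (VonNeumannAlgebra.mem_commutant_iff.1 hz _ ?_).symm
    exact mul_mem (mul_mem (mul_mem (mul_mem (hKM hp.mem) (hKM hk)) hy) (hKM hl)) (hKM hp.mem)
  have hsb := VonNeumannAlgebra.mem_commutant_iff.1 hb s hsR
  have hbp := VonNeumannAlgebra.mem_commutant_iff.1 hbK p hp.mem
  obtain ⟨e1, e2⟩ := corner_commute (K := K.commutant) (b := y) (y := b) (q := p) (k := k) (l := l)
    (by rw [VonNeumannAlgebra.commutant_commutant]; exact hp.mem)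
    (by rw [VonNeumannAlgebra.commutant_commutant]; exact hk)
    (by rw [VonNeumannAlgebra.commutant_commutant]; exact hl) hbK
  rw [mul_sub, sub_mul, sub_mul, ← e1, ← e2, ← hsp, mul_assoc s p b, hbp, ← mul_assoc,
    ← mul_assoc, hsb, sub_self]

/-- In a factor, a nonzero intertwiner between the identity and `Ad V` is a multiple of a unitary
implementing `Ad V`. -/
theorem IsFactor.intertwiner_eq_zero {N : VonNeumannAlgebra H} (hN : IsFactor N) {V : H →L[ℂ] H}
    (hVs : star V = V) (hVV : V * V = 1) (hVN : ∀ x ∈ N, V * x * V ∈ N)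
    (hout : ¬ ∃ u ∈ N, u ∈ unitary (H →L[ℂ] H) ∧ ∀ x ∈ N, V * x * star V = u * x * star u)
    {t : H →L[ℂ] H} (ht : t ∈ N) (h : ∀ n ∈ N, n * t = t * (V * n * V)) : t = 0 := by
  by_contra ht0
  apply hout
  have hs : ∀ n ∈ N, V * n * V * star t = star t * n := by
    intro n hn
    have := congrArg star (h (star n) (star_mem hn))
    simp only [star_mul, star_star, hVs] at this
    rw [this, ← mul_assoc]
  -- The intertwining relation and its adjoint put `t t*` and `t* t` in the center, so a nonzero `t`
  -- is a positive multiple of a unitary.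
  obtain ⟨c, hc⟩ := hN (t * star t) (mul_mem ht (star_mem ht)) (by
    rw [VonNeumannAlgebra.mem_commutant_iff]
    intro n hn
    rw [← mul_assoc, h n hn, mul_assoc, hs n hn, mul_assoc])
  obtain ⟨d, hd⟩ := hN (star t * t) (mul_mem (star_mem ht) ht) (by
    rw [VonNeumannAlgebra.mem_commutant_iff]
    intro n hn
    have hn' : V * (V * n * V) * V = n := by
      simp only [← mul_assoc, hVV, one_mul]
      rw [mul_assoc, hVV, mul_one]
    have e1 := hs _ (hVN n hn)
    have e2 := h _ (hVN n hn)
    rw [hn'] at e1 e2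
    rw [← mul_assoc, e1, mul_assoc, e2, mul_assoc])
  have hcd : c = d := by
    have h1 : t * star t * t = t * (star t * t) := mul_assoc _ _ _
    rw [hc, hd, smul_mul_assoc, one_mul, mul_smul_comm, mul_one, ← sub_eq_zero, ← sub_smul] at h1
    rcases smul_eq_zero.1 h1 with h1 | h1
    · exact sub_eq_zero.1 h1
    · exact absurd h1 ht0
  obtain ⟨v, hv⟩ : ∃ v, t v ≠ 0 := by
    by_contra! hcon
    exact ht0 (ContinuousLinearMap.ext hcon)
  have hv0 : v ≠ 0 := by
    rintro rfl
    exact hv (map_zero t)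
  have hdr : d = ((‖t v‖ / ‖v‖ : ℝ) : ℂ) ^ 2 := by
    have h1 : inner ℂ v ((star t * t) v) = inner ℂ v ((d • (1 : H →L[ℂ] H)) v) := by rw [hd]
    rw [mul_apply_eq_comp, ContinuousLinearMap.star_eq_adjoint,
      ContinuousLinearMap.adjoint_inner_right, inner_self_eq_norm_sq_to_K, smul_apply,
      inner_smul_right, one_apply_eq_self, inner_self_eq_norm_sq_to_K] at h1
    have hvn : (‖v‖ : ℂ) ≠ 0 := by exact_mod_cast norm_ne_zero_iff.2 hv0
    push_cast
    field_simp
    exact h1.symm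
  set r : ℝ := ‖t v‖ / ‖v‖ with hr
  have hr0 : (r : ℂ) ≠ 0 := by
    exact_mod_cast div_ne_zero (norm_ne_zero_iff.2 hv) (norm_ne_zero_iff.2 hv0)
  have hss : star ((r : ℂ)⁻¹ • t) = (r : ℂ)⁻¹ • star t := by
    rw [star_smul]
    congr 1
    simp
  have hu1 : star ((r : ℂ)⁻¹ • t) * ((r : ℂ)⁻¹ • t) = 1 := by
    rw [hss, smul_mul_smul_comm, hd, hdr, smul_smul]
    have : (r : ℂ)⁻¹ * (r : ℂ)⁻¹ * (r : ℂ) ^ 2 = 1 := by field_simp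
    rw [this, one_smul]
  have hu2 : ((r : ℂ)⁻¹ • t) * star ((r : ℂ)⁻¹ • t) = 1 := by
    rw [hss, smul_mul_smul_comm, hc, hcd, hdr, smul_smul]
    have : (r : ℂ)⁻¹ * (r : ℂ)⁻¹ * (r : ℂ) ^ 2 = 1 := by field_simp
    rw [this, one_smul]
  -- The adjoint is the right unitary, since `n t = t (V n V)` gives `V n V = u n u*` with `u` the
  -- normalized `t*`.
  refine ⟨star ((r : ℂ)⁻¹ • t), star_mem (smul_mem_vonNeumann N _ ht), ?_, ?_⟩
  · rw [Unitary.mem_iff, star_star]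
    exact ⟨hu2, hu1⟩
  · intro x hx
    have : x * ((r : ℂ)⁻¹ • t) = ((r : ℂ)⁻¹ • t) * (V * x * V) := by
      rw [mul_smul_comm, h x hx, smul_mul_assoc]
    rw [star_star, hVs, mul_assoc (star _) x, this, ← mul_assoc, hu1, one_mul]

/-- Every slice of `b` lies in `N` and inherits the intertwining relation, so it vanishes by
outerness. -/
theorem IsTypeIFactor.intertwiner_eq_zero_of_split {K M N : VonNeumannAlgebra H}
    (hK : IsTypeIFactor K) (hNK : N ≤ K) (hKM : K ≤ M) (hN : IsFactor N) {V : H →L[ℂ] H}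
    (hVs : star V = V) (hVV : V * V = 1) (hVN : ∀ x ∈ N, V * x * V ∈ N)
    (hout : ¬ ∃ u ∈ N, u ∈ unitary (H →L[ℂ] H) ∧ ∀ x ∈ N, V * x * star V = u * x * star u)
    {b : H →L[ℂ] H} (hb : b ∈ (relativeCommutant M N).commutant)
    (h : ∀ n ∈ N, n * b = b * (V * n * V)) : b = 0 := by
  obtain ⟨p, hp⟩ := hK.exists_minimalProjection
  obtain ⟨q, hq⟩ := hp.exists_commutant hK.1
  have hb' := commutant_le_commutant (relativeCommutant_mono hKM N) hb
  refine hK.1.commutant.eq_zero_of_corners hq.mem hq.star_eq hq.ne_zero ?_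
  intro k hk l hl
  obtain ⟨t, htN, htq⟩ := exists_slice hK.1 hNK hq hb' hk hl
  have ht0 : t = 0 := by
    refine hN.intertwiner_eq_zero hVs hVV hVN hout htN ?_
    intro n hn
    have hn' := hNK (hVN n hn)
    apply hK.1.eq_of_mul_commutant hq (mul_mem (hNK hn) (hNK htN)) (mul_mem (hNK htN) hn')
    have e1 := (corner_commute (b := b) hq.mem hk hl (hNK hn)).1
    have e2 := (corner_commute (b := b) hq.mem hk hl hn').2
    rw [mul_assoc, htq, e1, mul_assoc t (V * n * V) q,
      VonNeumannAlgebra.mem_commutant_iff.1 hq.mem _ hn',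
      ← mul_assoc t q, htq, e2, h n hn]
  rw [← htq, ht0, zero_mul]

/-! ### Even parts and their commutants -/

/-- Compression to the eigenspace `V = 1` sees only the even part `E` of `r`, and `y` commutes with
`E`. For homogeneous `y` the operator `y* y` is even and commutes with `P`, so the extension
criterion applies to `y P`. -/
theorem exists_extension_of_homogeneous (R : VonNeumannAlgebra H) {V y : H →L[ℂ] H}
    (hVs : star V = V) (hVV : V * V = 1) (hVR : ∀ r ∈ R, V * r * V ∈ R)
    (hy : V * y * V = y ∨ V * y * V = -y)
    (hc : ∀ r ∈ R, V * r * V = r → r * y = y * r) :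
    ∃ t ∈ R.commutant, t * (1 + V) = y * (1 + V) := by
  set P : H →L[ℂ] H := (2 : ℂ)⁻¹ • (1 + V) with hP
  clear_value P
  have hVP : V * P = P := by
    rw [hP, mul_smul_comm, mul_add, hVV, mul_one, add_comm]
  have hPV : P * V = P := by
    rw [hP, smul_mul_assoc, add_mul, hVV, one_mul, add_comm]
  have hPs : star P = P := by
    rw [hP, star_smul, star_add, star_one, hVs]
    congr 1
    simp
  have hPP : P * P = P := by
    nth_rw 1 [hP]
    rw [smul_mul_assoc, add_mul, one_mul, hVP, ← two_smul ℂ P, smul_smul]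
    norm_num
  have hVy : V * y = y * V ∨ V * y = -(y * V) := by
    rcases hy with h | h
    · left
      nth_rw 2 [← h]
      rw [mul_assoc, hVV, mul_one]
    · right
      rw [← neg_mul, ← h, mul_assoc, hVV, mul_one]
  have hyy : star y * y * V = V * (star y * y) := by
    rcases hVy with h | h
    · have h' : V * star y = star y * V := by
        have := congrArg star h
        simpa [hVs] using this.symm
      rw [← mul_assoc, h', mul_assoc, mul_assoc, h]
    · have h' : V * star y = -(star y * V) := by
        have := congrArg star h
        simp only [star_mul, star_neg, hVs] at this
        rw [this, neg_neg]
      rw [← mul_assoc, h', neg_mul, mul_assoc, mul_assoc, h, mul_neg, neg_neg]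
  have hyyP : star y * y * P = P * (star y * y) := by
    rw [hP, mul_smul_comm, smul_mul_assoc, mul_add, add_mul, hyy, mul_one, one_mul]
  have hyr : ∀ r : H →L[ℂ] H, V * (star y * r * y) * V = star y * (V * r * V) * y := by
    intro r
    rcases hVy with h | h
    · have h' : V * star y = star y * V := by
        have := congrArg star h
        simpa [hVs] using this.symm
      calc V * (star y * r * y) * V = V * star y * r * (y * V) := by simp only [mul_assoc]
        _ = _ := by rw [h', ← h]; simp only [mul_assoc]
    · have h' : V * star y = -(star y * V) := by
        have := congrArg star h
        simp only [star_mul, star_neg, hVs] at this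
        rw [this, neg_neg]
      have h2 : y * V = -(V * y) := by rw [h, neg_neg]
      calc V * (star y * r * y) * V = V * star y * r * (y * V) := by simp only [mul_assoc]
        _ = _ := by rw [h', h2]; simp only [mul_assoc, neg_mul, mul_neg, neg_neg]
  have hav : ∀ z : H →L[ℂ] H, P * z * P = P * ((2 : ℂ)⁻¹ • (z + V * z * V)) * P := by
    intro z
    have h1 : P * (V * z * V) * P = P * z * P := by
      calc P * (V * z * V) * P = (P * V) * z * (V * P) := by simp only [mul_assoc]
        _ = _ := by rw [hPV, hVP]
    rw [mul_smul_comm, smul_mul_assoc, mul_add, add_mul, h1, ← two_smul ℂ, smul_smul]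
    norm_num
  obtain ⟨t, ht1, ht2, -⟩ := exists_commutant_extension R.toStarSubalgebra P (y * P) hPs hPP
    (by rw [mul_assoc, hPP]) (by
      intro r hr
      set E : H →L[ℂ] H := (2 : ℂ)⁻¹ • (r + V * r * V) with hE
      have hER : E ∈ R := smul_mem_vonNeumann R _ (add_mem hr (hVR r hr))
      have hEV : V * E * V = E := by
        rw [hE, mul_smul_comm, smul_mul_assoc, mul_add, add_mul]
        have : V * (V * r * V) * V = r := by
          simp only [← mul_assoc, hVV, one_mul]
          rw [mul_assoc, hVV, mul_one]
        rw [this, add_comm]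
      have hEy : star y * E = E * star y := by
        have h1 : V * star E * V = star E := by
          have := congrArg star hEV
          simpa [hVs, mul_assoc] using this
        have := congrArg star (hc (star E) (star_mem hER) h1)
        simpa using this
      have hEs : (2 : ℂ)⁻¹ • (star y * r * y + V * (star y * r * y) * V) = star y * E * y := by
        rw [hyr, hE, mul_smul_comm, smul_mul_assoc, mul_add, add_mul]
      have h0 : star (y * P) * (y * P) = P * (star y * y) := by
        rw [star_mul, hPs, mul_assoc, ← mul_assoc (star y), hyyP, ← mul_assoc, hPP]
      rw [h0, hav r, ← hE, star_mul, hPs]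
      calc P * star y * r * (y * P) = P * (star y * r * y) * P := by simp only [mul_assoc]
        _ = P * (star y * E * y) * P := by rw [hav, hEs]
        _ = P * E * (star y * y * P) := by rw [hEy]; simp only [mul_assoc]
        _ = P * E * (P * P * (star y * y)) := by rw [hyyP, hPP]
        _ = _ := by simp only [mul_assoc])
  refine ⟨t, VonNeumannAlgebra.mem_commutant_iff.2 ht1, ?_⟩
  have h2 : (1 + V : H →L[ℂ] H) = (2 : ℂ) • P := by
    rw [hP, smul_smul]
    norm_num
  rw [h2, mul_smul_comm, ht2, mul_smul_comm]

/-- The commutant of the even part of `R` is `R' + R' V`. -/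
theorem exists_add_mul_of_commute_even (R : VonNeumannAlgebra H) {V x : H →L[ℂ] H}
    (hVs : star V = V) (hVV : V * V = 1) (hVR : ∀ r ∈ R, V * r * V ∈ R)
    (hc : ∀ r ∈ R, V * r * V = r → r * x = x * r) :
    ∃ a ∈ R.commutant, ∃ b ∈ R.commutant, x = a + b * V := by
  have hVVx : V * (V * x * V) * V = x := by
    simp only [← mul_assoc, hVV, one_mul]
    rw [mul_assoc, hVV, mul_one]
  have hc' : ∀ r ∈ R, V * r * V = r → r * (V * x * V) = V * x * V * r := by
    intro r hr hrV
    have hrV' : V * r = r * V := by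
      nth_rw 2 [← hrV]
      rw [mul_assoc, hVV, mul_one]
    calc r * (V * x * V) = r * V * x * V := by simp only [mul_assoc]
      _ = V * (r * x) * V := by rw [← hrV']; simp only [mul_assoc]
      _ = V * x * (r * V) := by rw [hc r hr hrV]; simp only [mul_assoc]
      _ = _ := by rw [← hrV']; simp only [mul_assoc]
  have hom : ∀ y : H →L[ℂ] H, (V * y * V = y ∨ V * y * V = -y) →
      (∀ r ∈ R, V * r * V = r → r * y = y * r) →
      ∃ a ∈ R.commutant, ∃ b ∈ R.commutant, (2 : ℂ) • y = a + b * V := by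
    intro y hy hcy
    obtain ⟨s, hs, hs'⟩ := exists_extension_of_homogeneous R hVs hVV hVR hy hcy
    -- Since `-V` induces the same grading, this treats the eigenspace `V = -1`; then `2y = s (1 +
    -- V) + t (1 - V)`.
    obtain ⟨t, ht, ht'⟩ := exists_extension_of_homogeneous R (V := -V) (y := y)
      (by rw [star_neg, hVs]) (by rw [neg_mul_neg, hVV]) (by simpa using hVR) (by simpa using hy)
      (by simpa using hcy)
    refine ⟨s + t, add_mem hs ht, s - t, sub_mem hs ht, ?_⟩
    calc (2 : ℂ) • y = y * (1 + V) + y * (1 + -V) := by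
          rw [← mul_add, two_smul]
          noncomm_ring
      _ = s * (1 + V) + t * (1 + -V) := by rw [hs', ht']
      _ = _ := by noncomm_ring
  obtain ⟨a, ha, b, hb, h1⟩ := hom (x + V * x * V)
    (Or.inl (by rw [mul_add, add_mul, hVVx, add_comm]))
    (fun r hr hrV => by rw [mul_add, add_mul, hc r hr hrV, hc' r hr hrV])
  obtain ⟨a', ha', b', hb', h2⟩ := hom (x - V * x * V)
    (Or.inr (by rw [mul_sub, sub_mul, hVVx, neg_sub]))
    (fun r hr hrV => by rw [mul_sub, sub_mul, hc r hr hrV, hc' r hr hrV])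
  refine ⟨(4 : ℂ)⁻¹ • (a + a'), smul_mem_vonNeumann _ _ (add_mem ha ha'),
    (4 : ℂ)⁻¹ • (b + b'), smul_mem_vonNeumann _ _ (add_mem hb hb'), ?_⟩
  have h3 : (4 : ℂ) • x = (a + b * V) + (a' + b' * V) := by
    rw [← h1, ← h2]
    module
  have h4 : x = (4 : ℂ)⁻¹ • ((4 : ℂ) • x) := by
    rw [smul_smul]
    norm_num
  rw [h4, h3, smul_mul_assoc, ← smul_add]
  congr 1
  noncomm_ring

/-- For a split inclusion `N ⊆ M` of factors on which the grading is outer or trivial, the algebra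
`M` is generated by `N` and the even part of `M ∧ N'`. -/
theorem IsTypeIFactor.mem_commutant_of_commute_even {K M N : VonNeumannAlgebra H}
    (hK : IsTypeIFactor K) (hNK : N ≤ K) (hKM : K ≤ M) (hN : IsFactor N) (hM : IsFactor M)
    {V : H →L[ℂ] H} (hVs : star V = V) (hVV : V * V = 1) (hVN : ∀ x ∈ N, V * x * V ∈ N)
    (hVM : ∀ x ∈ M, V * x * V ∈ M)
    (hout : (∀ x ∈ M, V * x * V = x) ∨
      ¬ ∃ u ∈ N, u ∈ unitary (H →L[ℂ] H) ∧ ∀ x ∈ N, V * x * star V = u * x * star u)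
    {x : H →L[ℂ] H} (hxN : x ∈ N.commutant)
    (hx : ∀ r ∈ M, r ∈ N.commutant → V * r * V = r → r * x = x * r) : x ∈ M.commutant := by
  have inv : ∀ z : H →L[ℂ] H, V * (V * z * V) * V = z := by
    intro z
    simp only [← mul_assoc, hVV, one_mul]
    rw [mul_assoc, hVV, mul_one]
  set R := relativeCommutant M N with hR
  have hVR : ∀ r ∈ R, V * r * V ∈ R := by
    intro r hr
    rw [hR, mem_relativeCommutant] at hr ⊢
    refine ⟨hVM r hr.1, VonNeumannAlgebra.mem_commutant_iff.2 fun n hn => ?_⟩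
    have h1 := VonNeumannAlgebra.mem_commutant_iff.1 hr.2 _ (hVN n hn)
    calc n * (V * r * V) = V * (V * n * V * r) * V := by
          rw [← mul_assoc, ← mul_assoc, ← mul_assoc, ← mul_assoc, ← mul_assoc, hVV, one_mul]
      _ = V * (r * (V * n * V)) * V := by rw [h1]
      _ = V * r * V * n * (V * V) := by simp only [mul_assoc]
      _ = _ := by rw [hVV, mul_one]
  have hxR : ∀ r ∈ R, V * r * V = r → r * x = x * r := by
    intro r hr
    rw [hR, mem_relativeCommutant] at hr
    exact hx r hr.1 hr.2
  have hNR : N ≤ R.commutant := by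
    intro n hn
    rw [VonNeumannAlgebra.mem_commutant_iff]
    intro r hr
    exact (VonNeumannAlgebra.mem_commutant_iff.1 (mem_relativeCommutant.1 hr).2 n hn).symm
  -- Without odd elements `R` is even, so `x ∈ R'` directly; trivial grading always falls in this
  -- case.
  by_cases hodd : ∀ s ∈ R, V * s * V = -s → s = 0
  · refine hK.mem_commutant_of_split hNK hKM hN ?_ hxN
    rw [VonNeumannAlgebra.mem_commutant_iff]
    intro r hr
    refine hxR r hr ?_
    have := hodd (r - V * r * V) (sub_mem hr (hVR r hr)) (by rw [mul_sub, sub_mul, inv, neg_sub])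
    exact (sub_eq_zero.1 this).symm
  push Not at hodd
  obtain ⟨s, hsR, hsV, hs0⟩ := hodd
  have hout' : ¬ ∃ u ∈ N, u ∈ unitary (H →L[ℂ] H) ∧
      ∀ x ∈ N, V * x * star V = u * x * star u := by
    refine hout.resolve_left fun htriv => hs0 ?_
    have h1 := htriv s (mem_relativeCommutant.1 hsR).1
    rw [hsV] at h1
    have h2 : (2 : ℂ) • s = 0 := by
      rw [two_smul]
      nth_rw 1 [← h1]
      exact neg_add_cancel s
    exact (smul_eq_zero.1 h2).resolve_left two_ne_zero
  have hRf : IsFactor R := by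
    intro z hz hz'
    have h1 := mem_relativeCommutant.1 hz
    exact hM z h1.1 (hK.mem_commutant_of_split hNK hKM hN hz' h1.2)
  have hVs' : V * s = -(s * V) := by
    rw [← neg_mul, ← hsV, mul_assoc, hVV, mul_one]
  -- Multiplying by the odd `s` from the left and from the right gives `s c ± s d V = 0`, hence `s d
  -- = 0`, and `R` is a factor.
  have huniq : ∀ c ∈ R.commutant, ∀ d ∈ R.commutant, c + d * V = 0 → d = 0 := by
    intro c hc d hd hcd
    refine hRf.eq_zero_of_mul_eq_zero hsR hs0 hd ?_
    have hcs := VonNeumannAlgebra.mem_commutant_iff.1 hc s hsR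
    have hds := VonNeumannAlgebra.mem_commutant_iff.1 hd s hsR
    have e1 : s * c + s * d * V = 0 := by
      rw [mul_assoc, ← mul_add, hcd, mul_zero]
    have e2 : s * c - s * d * V = 0 := by
      have : (c + d * V) * s = 0 := by rw [hcd, zero_mul]
      rw [add_mul, mul_assoc, hVs', mul_neg, ← mul_assoc, ← hcs, ← hds] at this
      rwa [sub_eq_add_neg]
    have e3 : s * d * V = 0 := by
      have : (2 : ℂ) • (s * d * V) = 0 := by
        rw [two_smul]
        calc s * d * V + s * d * V = (s * c + s * d * V) - (s * c - s * d * V) := by abel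
          _ = 0 := by rw [e1, e2, sub_zero]
      exact (smul_eq_zero.1 this).resolve_left two_ne_zero
    rw [← hds]
    calc s * d = s * d * V * V := by rw [mul_assoc (s * d), hVV, mul_one]
      _ = 0 := by rw [e3, zero_mul]
  obtain ⟨a, ha, b, hb, hab⟩ := exists_add_mul_of_commute_even R hVs hVV hVR hxR
  -- This is the commutator of `n` with `x = a + b V`, using `V n = (V n V) V`. Both coefficients
  -- lie in `R'`, so uniqueness separates them.
  have hcomm : ∀ n ∈ N, (n * a - a * n) + (n * b - b * (V * n * V)) * V = 0 := by
    intro n hn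
    have h1 := VonNeumannAlgebra.mem_commutant_iff.1 hxN n hn
    rw [hab] at h1
    have h2 : b * (V * n * V) * V = b * V * n := by
      calc b * (V * n * V) * V = b * V * n * (V * V) := by simp only [mul_assoc]
        _ = _ := by rw [hVV, mul_one]
    rw [sub_mul, h2]
    calc _ = n * (a + b * V) - (a + b * V) * n := by noncomm_ring
      _ = 0 := by rw [h1, sub_self]
  have hb' : ∀ n ∈ N, n * b - b * (V * n * V) = 0 := by
    intro n hn
    refine huniq _ ?_ _ ?_ (hcomm n hn)
    · exact sub_mem (mul_mem (hNR hn) ha) (mul_mem ha (hNR hn))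
    · exact sub_mem (mul_mem (hNR hn) hb) (mul_mem hb (hNR (hVN n hn)))
  have hb0 : b = 0 := hK.intertwiner_eq_zero_of_split hNK hKM hN hVs hVV hVN hout' hb
    fun n hn => sub_eq_zero.1 (hb' n hn)
  have haN : a ∈ N.commutant := by
    rw [VonNeumannAlgebra.mem_commutant_iff]
    intro n hn
    have := hcomm n hn
    rw [hb' n hn, zero_mul, add_zero] at this
    exact sub_eq_zero.1 this
  rw [hab, hb0, zero_mul, add_zero]
  exact hK.mem_commutant_of_split hNK hKM hN ha haN

/-- An even operator commutes with `V`, hence with `Z` and `Z*`; the twist is invisible to it. -/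
theorem mem_centralizer_twisted {V : H →L[ℂ] H} (hVs : star V = V) (hVV : V * V = 1)
    {N : VonNeumannAlgebra H} {r : H →L[ℂ] H} (hr : r ∈ N.commutant) (hrV : V * r * V = r) :
    r ∈ Set.centralizer (twisted V N) := by
  have h1 : Commute r V := by
    change r * V = V * r
    nth_rw 1 [← hrV]
    rw [mul_assoc, hVV, mul_one]
  have h2 : Commute r (star V) := by rwa [hVs]
  have h3 : Commute r (twistOperator V) :=
    ((Commute.one_right r).add_right (h1.smul_right _)).smul_right _
  have h4 : Commute r (star (twistOperator V)) := by
    unfold twistOperator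
    simp only [star_smul, star_add, star_one]
    exact ((Commute.one_right r).add_right (h2.smul_right _)).smul_right _
  rintro _ ⟨n, hn, rfl⟩
  have h5 : Commute r n := (VonNeumannAlgebra.mem_commutant_iff.1 hr n hn).symm
  exact ((h3.mul_right h5).mul_right h4).eq.symm

end SplitInclusions

end SolitonNet

namespace SolitonNet

/-! ### Double cones as rectangles in light-cone coordinates -/

section LightConeCoordinates

/-- The double cone `(a, b) × (c, d)` in the light-cone coordinates `t - x` and `t + x`. -/
def lightRect (a b c d : ℝ) : Set Minkowski :=
  {x | a < x.1 - x.2 ∧ x.1 - x.2 < b ∧ c < x.1 + x.2 ∧ x.1 + x.2 < d}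

/-- The point with light-cone coordinates `t - x = u` and `t + x = v`. -/
noncomputable def lightPoint (u v : ℝ) : Minkowski := ((u + v) / 2, (v - u) / 2)

theorem lightPoint_sub (u v : ℝ) : (lightPoint u v).1 - (lightPoint u v).2 = u := by
  simp only [lightPoint]; ring

theorem lightPoint_add (u v : ℝ) : (lightPoint u v).1 + (lightPoint u v).2 = v := by
  simp only [lightPoint]; ring

theorem lightPoint_mem_lightRect {a b c d u v : ℝ} :
    lightPoint u v ∈ lightRect a b c d ↔ a < u ∧ u < b ∧ c < v ∧ v < d := by
  simp only [lightRect, Set.mem_ofPred_eq, lightPoint_sub, lightPoint_add]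

theorem inFuture_iff {x y : Minkowski} :
    InFuture x y ↔ x.1 - x.2 < y.1 - y.2 ∧ x.1 + x.2 < y.1 + y.2 := by
  unfold InFuture
  rw [abs_lt]
  constructor
  · rintro ⟨h1, h2⟩; constructor <;> linarith
  · rintro ⟨h1, h2⟩; constructor <;> linarith

theorem isDoubleCone_iff {S : Set Minkowski} :
    IsDoubleCone S ↔ ∃ a b c d : ℝ, a < b ∧ c < d ∧ S = lightRect a b c d := by
  constructor
  · rintro ⟨p, q, h, rfl⟩
    obtain ⟨h1, h2⟩ := inFuture_iff.1 h
    refine ⟨_, _, _, _, h1, h2, ?_⟩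
    ext x
    simp only [Set.mem_ofPred_eq, inFuture_iff, lightRect]
    tauto
  · rintro ⟨a, b, c, d, h1, h2, rfl⟩
    refine ⟨lightPoint a c, lightPoint b d, ?_, ?_⟩
    · simp only [inFuture_iff, lightPoint_sub, lightPoint_add]
      exact ⟨h1, h2⟩
    · ext x
      simp only [Set.mem_ofPred_eq, inFuture_iff, lightRect, lightPoint_sub, lightPoint_add]
      tauto

theorem spacelike_iff {x y : Minkowski} :
    Spacelike x y ↔ ((y.1 - y.2) - (x.1 - x.2)) * ((y.1 + y.2) - (x.1 + x.2)) < 0 := by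
  unfold Spacelike
  rw [← sq_lt_sq]
  constructor <;> intro h <;> nlinarith

theorem closure_lightRect_subset (a b c d : ℝ) : closure (lightRect a b c d) ⊆
    {x | a ≤ x.1 - x.2 ∧ x.1 - x.2 ≤ b ∧ c ≤ x.1 + x.2 ∧ x.1 + x.2 ≤ d} := by
  refine closure_minimal (fun x hx => ⟨hx.1.le, hx.2.1.le, hx.2.2.1.le, hx.2.2.2.le⟩) ?_
  have hu : Continuous fun x : Minkowski => x.1 - x.2 := by fun_prop
  have hv : Continuous fun x : Minkowski => x.1 + x.2 := by fun_prop
  exact (isClosed_le continuous_const hu).inter ((isClosed_le hu continuous_const).inter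
    ((isClosed_le continuous_const hv).inter (isClosed_le hv continuous_const)))

theorem le_of_lightRect_subset {a b c d a' b' c' d' : ℝ} (hab : a < b) (hcd : c < d)
    (h : lightRect a b c d ⊆ lightRect a' b' c' d') : a' ≤ a ∧ b ≤ b' ∧ c' ≤ c ∧ d ≤ d' := by
  have key : ∀ u v, a < u → u < b → c < v → v < d → a' < u ∧ u < b' ∧ c' < v ∧ v < d' :=
    fun u v h1 h2 h3 h4 => lightPoint_mem_lightRect.1
      (h (lightPoint_mem_lightRect.2 ⟨h1, h2, h3, h4⟩))
  obtain ⟨u, hu1, hu2⟩ := exists_between hab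
  obtain ⟨v, hv1, hv2⟩ := exists_between hcd
  refine ⟨?_, ?_, ?_, ?_⟩ <;> by_contra! hlt
  · obtain ⟨w, h1, h2⟩ := exists_between (lt_min hlt hab)
    have := (key w v h1 (lt_of_lt_of_le h2 (min_le_right _ _)) hv1 hv2).1
    linarith [min_le_left a' b]
  · obtain ⟨w, h1, h2⟩ := exists_between (max_lt hlt hab)
    have := (key w v (lt_of_le_of_lt (le_max_right _ _) h1) h2 hv1 hv2).2.1
    linarith [le_max_left b' a]
  · obtain ⟨w, h1, h2⟩ := exists_between (lt_min hlt hcd)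
    have := (key u w hu1 hu2 h1 (lt_of_lt_of_le h2 (min_le_right _ _))).2.2.1
    linarith [min_le_left c' d]
  · obtain ⟨w, h1, h2⟩ := exists_between (max_lt hlt hcd)
    have := (key u w hu1 hu2 (lt_of_le_of_lt (le_max_right _ _) h1) h2).2.2.2
    linarith [le_max_left d' c]

theorem le_or_le_of_disjoint_Ioo {a b a' b' : ℝ} (hab : a < b) (hab' : a' < b')
    (h : ∀ u, a < u → u < b → a' < u → u < b' → False) : b ≤ a' ∨ b' ≤ a := by
  by_contra! hcon
  obtain ⟨u, h1, h2⟩ := exists_between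
    (max_lt (lt_min hab hcon.2) (lt_min hcon.1 hab') : max a a' < min b b')
  exact h u (lt_of_le_of_lt (le_max_left _ _) h1) (lt_of_lt_of_le h2 (min_le_left _ _))
    (lt_of_le_of_lt (le_max_right _ _) h1) (lt_of_lt_of_le h2 (min_le_right _ _))

/-- Points sharing a light-cone coordinate are not spacelike, so the intervals are disjoint in each
coordinate. The sign condition then forces opposite orders in the two coordinates. -/
theorem spacelikeRegions_lightRect {a b c d a' b' c' d' : ℝ} (hab : a < b) (hcd : c < d)
    (hab' : a' < b') (hcd' : c' < d')
    (h : SpacelikeRegions (lightRect a b c d) (lightRect a' b' c' d')) :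
    (b ≤ a' ∧ d' ≤ c) ∨ (b' ≤ a ∧ d ≤ c') := by
  have key : ∀ u v u' v', a < u → u < b → c < v → v < d → a' < u' → u' < b' → c' < v' →
      v' < d' → (u' - u) * (v' - v) < 0 := by
    intro u v u' v' h1 h2 h3 h4 h5 h6 h7 h8
    have := spacelike_iff.1 (h _ (lightPoint_mem_lightRect.2 ⟨h1, h2, h3, h4⟩) _
      (lightPoint_mem_lightRect.2 ⟨h5, h6, h7, h8⟩))
    simpa only [lightPoint_sub, lightPoint_add] using this
  obtain ⟨u, hu1, hu2⟩ := exists_between hab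
  obtain ⟨v, hv1, hv2⟩ := exists_between hcd
  obtain ⟨u', hu1', hu2'⟩ := exists_between hab'
  obtain ⟨v', hv1', hv2'⟩ := exists_between hcd'
  have h0 := key u v u' v' hu1 hu2 hv1 hv2 hu1' hu2' hv1' hv2'
  have h1 := le_or_le_of_disjoint_Ioo hab hab' (fun w h1 h2 h3 h4 => by
    have := key w v w v' h1 h2 hv1 hv2 h3 h4 hv1' hv2'
    simp at this)
  have h2 := le_or_le_of_disjoint_Ioo hcd hcd' (fun w h1 h2 h3 h4 => by
    have := key u w u' w hu1 hu2 h1 h2 hu1' hu2' h3 h4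
    simp at this)
  rcases h1 with h1 | h1 <;> rcases h2 with h2 | h2
  · exfalso
    have e1 : 0 < u' - u := by linarith
    have e2 : 0 < v' - v := by linarith
    nlinarith [mul_pos e1 e2]
  · exact Or.inl ⟨h1, h2⟩
  · exact Or.inr ⟨h1, h2⟩
  · exfalso
    have e1 : 0 < u - u' := by linarith
    have e2 : 0 < v - v' := by linarith
    nlinarith [mul_pos e1 e2]

theorem spacelikeComplement_lightRect {a b c d : ℝ} (hab : a < b) (hcd : c < d) :
    spacelikeComplement (lightRect a b c d) =
      {x | x.1 - x.2 < a ∧ d < x.1 + x.2} ∪ {x | b < x.1 - x.2 ∧ x.1 + x.2 < c} := by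
  have hsub : ∀ u v : ℝ, (∀ x ∈ lightRect a b c d, Spacelike x (lightPoint u v)) →
      (u ≤ a ∨ b ≤ u) ∧ (v ≤ c ∨ d ≤ v) := by
    intro u v h
    have key : ∀ u' v', a < u' → u' < b → c < v' → v' < d → (u - u') * (v - v') < 0 := by
      intro u' v' h1 h2 h3 h4
      have := spacelike_iff.1 (h _ (lightPoint_mem_lightRect.2 ⟨h1, h2, h3, h4⟩))
      simpa only [lightPoint_sub, lightPoint_add] using this
    obtain ⟨u', hu1, hu2⟩ := exists_between hab
    obtain ⟨v', hv1, hv2⟩ := exists_between hcd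
    constructor <;> by_contra! hcon
    · have := key u v' hcon.1 hcon.2 hv1 hv2
      simp at this
    · have := key u' v hu1 hu2 hcon.1 hcon.2
      simp at this
  have hlp : ∀ x : Minkowski, lightPoint (x.1 - x.2) (x.1 + x.2) = x := by
    intro x
    simp only [lightPoint]
    ext <;> simp only <;> ring
  apply Set.Subset.antisymm
  · intro x hx
    have hmid := interior_subset hx
    have hev : ∀ᶠ y in nhds x, y ∈ {y | ∀ z ∈ lightRect a b c d, Spacelike z y} :=
      mem_interior_iff_mem_nhds.1 hx
    -- Being interior allows small shifts along each light-cone coordinate. A shift of at most half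
    -- the side length would move a point on a line `u = a`, `u = b`, `v = c` or `v = d` into the
    -- forbidden strip.
    have hline : ∀ e f : ℝ, ∃ δ : ℝ, 0 < δ ∧ ∀ s : ℝ, |s| < δ →
        ∀ z ∈ lightRect a b c d,
          Spacelike z (lightPoint (x.1 - x.2 + s * e) (x.1 + x.2 + s * f)) := by
      intro e f
      have hcont : Continuous fun s : ℝ =>
          lightPoint (x.1 - x.2 + s * e) (x.1 + x.2 + s * f) := by
        unfold lightPoint
        fun_prop
      have h0 : Filter.Tendsto (fun s : ℝ =>
          lightPoint (x.1 - x.2 + s * e) (x.1 + x.2 + s * f)) (nhds 0) (nhds x) := by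
        have := hcont.tendsto 0
        simpa [hlp] using this
      obtain ⟨δ, hδ, hball⟩ := Metric.eventually_nhds_iff.1 (h0.eventually hev)
      refine ⟨δ, hδ, fun s hs => hball ?_⟩
      rwa [Real.dist_eq, sub_zero]
    have hx0 := hsub _ _ (by rw [hlp]; exact hmid)
    have hua : x.1 - x.2 ≠ a ∧ x.1 - x.2 ≠ b := by
      obtain ⟨δ, hδ, hs⟩ := hline 1 0
      have hpos : 0 < min (δ / 2) ((b - a) / 2) := lt_min (by linarith) (by linarith)
      have hm1 := min_le_left (δ / 2) ((b - a) / 2)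
      have hm2 := min_le_right (δ / 2) ((b - a) / 2)
      set s := min (δ / 2) ((b - a) / 2)
      have e1 := (hsub _ _ (hs s (by rw [abs_of_pos hpos]; linarith))).1
      have e2 := (hsub _ _ (hs (-s) (by rw [abs_neg, abs_of_pos hpos]; linarith))).1
      constructor <;> intro heq
      · rcases e1 with e1 | e1 <;> linarith
      · rcases e2 with e2 | e2 <;> linarith
    have hvc : x.1 + x.2 ≠ c ∧ x.1 + x.2 ≠ d := by
      obtain ⟨δ, hδ, hs⟩ := hline 0 1
      have hpos : 0 < min (δ / 2) ((d - c) / 2) := lt_min (by linarith) (by linarith)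
      have hm1 := min_le_left (δ / 2) ((d - c) / 2)
      have hm2 := min_le_right (δ / 2) ((d - c) / 2)
      set s := min (δ / 2) ((d - c) / 2)
      have e1 := (hsub _ _ (hs s (by rw [abs_of_pos hpos]; linarith))).2
      have e2 := (hsub _ _ (hs (-s) (by rw [abs_neg, abs_of_pos hpos]; linarith))).2
      constructor <;> intro heq
      · rcases e1 with e1 | e1 <;> linarith
      · rcases e2 with e2 | e2 <;> linarith
    obtain ⟨u, hu1, hu2⟩ := exists_between hab
    obtain ⟨v, hv1, hv2⟩ := exists_between hcd
    have hprod := spacelike_iff.1 (hmid _ (lightPoint_mem_lightRect.2 ⟨hu1, hu2, hv1, hv2⟩))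
    rw [lightPoint_sub, lightPoint_add] at hprod
    rcases hx0 with ⟨h1 | h1, h2 | h2⟩
    · exfalso
      have e1 : 0 < u - (x.1 - x.2) := by linarith
      have e2 : 0 < v - (x.1 + x.2) := by linarith
      nlinarith [mul_pos e1 e2]
    · exact Or.inl ⟨lt_of_le_of_ne h1 hua.1, lt_of_le_of_ne h2 hvc.2.symm⟩
    · exact Or.inr ⟨lt_of_le_of_ne h1 hua.2.symm, lt_of_le_of_ne h2 hvc.1⟩
    · exfalso
      have e1 : 0 < (x.1 - x.2) - u := by linarith
      have e2 : 0 < (x.1 + x.2) - v := by linarith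
      nlinarith [mul_pos e1 e2]
  · apply interior_maximal
    · rintro x (⟨h1, h2⟩ | ⟨h1, h2⟩) z ⟨hz1, hz2, hz3, hz4⟩ <;> rw [spacelike_iff]
      · exact mul_neg_of_neg_of_pos (by linarith) (by linarith)
      · exact mul_neg_of_pos_of_neg (by linarith) (by linarith)
    · have hu : Continuous fun x : Minkowski => x.1 - x.2 := by fun_prop
      have hv : Continuous fun x : Minkowski => x.1 + x.2 := by fun_prop
      exact ((isOpen_lt hu continuous_const).inter (isOpen_lt continuous_const hv)).union
        ((isOpen_lt continuous_const hu).inter (isOpen_lt hv continuous_const))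

end LightConeCoordinates

/-! ### Strong additivity -/

section StrongAdditivity

variable {H : Type*} [NormedAddCommGroup H] [InnerProductSpace ℂ H] [CompleteSpace H]

namespace GradedLocalNet

/-- Passing to commutants, an `x` commuting with `F(O₁)` and `F(O₂)` commutes with `F(P)` and, by
minimality, with the even part of `F(Q) ∧ F(P)'`. The split argument then gives `x ∈ F(Q)'`. -/
theorem alg_le_vnJoin (F : GradedLocalNet H) (h_split : F.SplitProperty)
    (h_factors : F.LocalFactors) (h_minimal : F.MinimalTwistedCommutants)
    (h_outer : F.PurelyBosonic ∨ F.GradingOuter) {P Q O₁ O₂ O₃ : DoubleCone}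
    (hPQ : CompactlyInside P Q) (hcomp : AreComplementComponents P Q O₁ O₃)
    (hP : P ≤ O₂) (hO₃ : O₃ ≤ O₂) : F.alg Q ≤ vnJoin (F.alg O₁) (F.alg O₂) := by
  obtain ⟨K, hK, hNK, hKM⟩ := h_split P Q hPQ
  have hgr : ∀ O : DoubleCone, ∀ x ∈ F.alg O, F.V * x * F.V ∈ F.alg O := by
    intro O x hx
    have := F.grading O x hx
    rwa [F.V_selfAdjoint] at this
  intro y hy
  apply mem_of_commute_commutant
  intro x hx
  have hx' := mem_commutant_vnJoin.1 hx
  have hxM : x ∈ (F.alg Q).commutant := by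
    refine hK.mem_commutant_of_commute_even hNK hKM (h_factors P) (h_factors Q) F.V_selfAdjoint
      F.V_sq (hgr P) (hgr Q) ?_ (commutant_le_commutant (F.isotony P O₂ hP) hx'.2) ?_
    · rcases h_outer with h | h
      · left
        intro z hz
        have := h Q z hz
        rwa [F.V_selfAdjoint] at this
      · exact Or.inr (h P)
    · intro r hrQ hrP hrV
      have hr : r ∈ (vnJoin (F.alg O₁) (F.alg O₃) : Set (H →L[ℂ] H)) := by
        rw [← h_minimal P Q O₁ O₃ hPQ hcomp]
        exact ⟨hrQ, mem_centralizer_twisted F.V_selfAdjoint F.V_sq hrP hrV⟩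
      have hr' : r ∈ vnJoin (F.alg O₁) (F.alg O₂) :=
        vnJoin_le (le_vnJoin_left _ _) ((F.isotony O₃ O₂ hO₃).trans (le_vnJoin_right _ _)) hr
      exact VonNeumannAlgebra.mem_commutant_iff.1 hx r hr'
  exact (VonNeumannAlgebra.mem_commutant_iff.1 hxM y hy).symm

theorem strongAdditivity_lightRect (F : GradedLocalNet H) (h_split : F.SplitProperty)
    (h_factors : F.LocalFactors) (h_minimal : F.MinimalTwistedCommutants)
    (h_outer : F.PurelyBosonic ∨ F.GradingOuter) (O₁ O₂ : DoubleCone) {a b b' c' c d : ℝ}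
    (hab : a < b) (hbb : b < b') (hcc : c' < c) (hcd : c < d)
    (h1 : O₁.1 = lightRect a b c d) (h2 : O₂.1 = lightRect b b' c' c) :
    ∃ Q : DoubleCone, IsLeast {R : DoubleCone | O₁ ≤ R ∧ O₂ ≤ R} Q ∧
      vnJoin (F.alg O₁) (F.alg O₂) = F.alg Q := by
  set Q : DoubleCone := ⟨lightRect a b' c' d, isDoubleCone_iff.2
    ⟨a, b', c', d, hab.trans hbb, hcc.trans hcd, rfl⟩⟩ with hQ
  have hO₁Q : O₁ ≤ Q := by
    change O₁.1 ⊆ lightRect a b' c' d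
    rw [h1]
    rintro x ⟨e1, e2, e3, e4⟩
    exact ⟨e1, e2.trans hbb, hcc.trans e3, e4⟩
  have hO₂Q : O₂ ≤ Q := by
    change O₂.1 ⊆ lightRect a b' c' d
    rw [h2]
    rintro x ⟨e1, e2, e3, e4⟩
    exact ⟨hab.trans e1, e2, e3, e4.trans hcd⟩
  refine ⟨Q, ⟨⟨hO₁Q, hO₂Q⟩, ?_⟩, ?_⟩
  · rintro ⟨S, hS⟩ ⟨hR1, hR2⟩
    obtain ⟨a₀, b₀, c₀, d₀, -, -, rfl⟩ := isDoubleCone_iff.1 hS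
    change O₁.1 ⊆ lightRect a₀ b₀ c₀ d₀ at hR1
    change O₂.1 ⊆ lightRect a₀ b₀ c₀ d₀ at hR2
    rw [h1] at hR1
    rw [h2] at hR2
    obtain ⟨k1, -, -, k4⟩ := le_of_lightRect_subset hab hcd hR1
    obtain ⟨-, k2, k3, -⟩ := le_of_lightRect_subset hbb hcc hR2
    rintro x ⟨e1, e2, e3, e4⟩
    exact ⟨lt_of_le_of_lt k1 e1, lt_of_lt_of_le e2 k2, lt_of_le_of_lt k3 e3,
      lt_of_lt_of_le e4 k4⟩
  · refine le_antisymm (vnJoin_le (F.isotony _ _ hO₁Q) (F.isotony _ _ hO₂Q)) ?_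
    -- The cone `P = (b, β) × (γ, c)` keeps the corner `(b, c)` shared with `O₁`, so `O₁` is exactly
    -- one complement component in `Q`, and `(β, b') × (c', γ) ⊆ O₂` is the other.
    obtain ⟨β, hβ1, hβ2⟩ := exists_between hbb
    obtain ⟨γ, hγ1, hγ2⟩ := exists_between hcc
    refine F.alg_le_vnJoin h_split h_factors h_minimal h_outer
      (P := ⟨lightRect b β γ c, isDoubleCone_iff.2 ⟨b, β, γ, c, hβ1, hγ2, rfl⟩⟩)
      (O₃ := ⟨lightRect β b' c' γ, isDoubleCone_iff.2 ⟨β, b', c', γ, hβ2, hγ1, rfl⟩⟩) ?_ ⟨?_, ?_⟩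
      ?_ ?_
    · intro x hx
      obtain ⟨e1, e2, e3, e4⟩ := closure_lightRect_subset _ _ _ _ hx
      exact ⟨lt_of_lt_of_le hab e1, lt_of_le_of_lt e2 hβ2, lt_of_lt_of_le hγ1 e3,
        lt_of_le_of_lt e4 hcd⟩
    · rw [h1, Set.disjoint_left]
      rintro x ⟨-, e2, -, -⟩ ⟨k1, -, -, -⟩
      exact lt_asymm (e2.trans hβ1) k1
    · rw [h1, spacelikeComplement_lightRect hβ1 hγ2]
      ext x
      constructor
      · rintro ⟨⟨e1, e2, e3, e4⟩, ⟨k1, k2⟩ | ⟨k1, k2⟩⟩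
        · exact Or.inl ⟨e1, k1, k2, e4⟩
        · exact Or.inr ⟨k1, e2, e3, k2⟩
      · rintro (⟨e1, e2, e3, e4⟩ | ⟨e1, e2, e3, e4⟩)
        · exact ⟨⟨e1, e2.trans hbb, hcc.trans e3, e4⟩, Or.inl ⟨e2, e3⟩⟩
        · exact ⟨⟨(hab.trans hβ1).trans e1, e2, e3, e4.trans (hγ2.trans hcd)⟩, Or.inr ⟨e1, e4⟩⟩
    · change lightRect b β γ c ⊆ O₂.1
      rw [h2]
      rintro x ⟨e1, e2, e3, e4⟩
      exact ⟨e1, e2.trans hβ2, hγ1.trans e3, e4⟩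
    · change lightRect β b' c' γ ⊆ O₂.1
      rw [h2]
      rintro x ⟨e1, e2, e3, e4⟩
      exact ⟨hβ1.trans e1, e2, e3, e4.trans hγ2⟩

end GradedLocalNet

end StrongAdditivity

end SolitonNet

theorem mainTheorem7 {H : Type*} [NormedAddCommGroup H] [InnerProductSpace ℂ H] [CompleteSpace H]
    (F : SolitonNet.GradedLocalNet H)
    (h_duality : F.TwistedDuality)
    (h_split : F.SplitProperty)
    (h_factors : F.LocalFactors)
    (h_minimal : F.MinimalTwistedCommutants)
    (h_outer : F.PurelyBosonic ∨ F.GradingOuter)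
    (O₁ O₂ : SolitonNet.DoubleCone)
    (h_spacelike : SolitonNet.SpacelikeRegions O₁.1 O₂.1)
    (h_boundary : (frontier O₁.1 ∩ frontier O₂.1).Nonempty) :
    ∃ Q : SolitonNet.DoubleCone,
      IsLeast {R : SolitonNet.DoubleCone | O₁ ≤ R ∧ O₂ ≤ R} Q ∧
        SolitonNet.vnJoin (F.alg O₁) (F.alg O₂) = F.alg Q := by
  obtain ⟨a, b, c, d, hab, hcd, h1⟩ := SolitonNet.isDoubleCone_iff.1 O₁.2
  obtain ⟨a', b', c', d', hab', hcd', h2⟩ := SolitonNet.isDoubleCone_iff.1 O₂.2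
  obtain ⟨w, hw1, hw2⟩ := h_boundary
  rw [h1] at hw1 h_spacelike
  rw [h2] at hw2 h_spacelike
  obtain ⟨e1, e2, e3, e4⟩ := SolitonNet.closure_lightRect_subset _ _ _ _ hw1.1
  obtain ⟨k1, k2, k3, k4⟩ := SolitonNet.closure_lightRect_subset _ _ _ _ hw2.1
  rcases SolitonNet.spacelikeRegions_lightRect hab hcd hab' hcd' h_spacelike with
    ⟨hu, hv⟩ | ⟨hu, hv⟩
  · have hu' : b = a' := le_antisymm hu (k1.trans e2)
    have hv' : d' = c := le_antisymm hv (e3.trans k4)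
    subst hu' hv'
    exact F.strongAdditivity_lightRect h_split h_factors h_minimal h_outer O₁ O₂ hab hab' hcd' hcd
      h1 h2
  · have hu' : b' = a := le_antisymm hu (e1.trans k2)
    have hv' : d = c' := le_antisymm hv (k3.trans e4)
    subst hu' hv'
    have := F.strongAdditivity_lightRect h_split h_factors h_minimal h_outer O₂ O₁ hab' hab hcd
      hcd' h2 h1
    rw [SolitonNet.vnJoin_comm]
    simpa only [and_comm] using this
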